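/- Let $G$ be a compact, simple, simply connected Lie group with normalized Haar measure $dh$, $\int_G dh=1$. For every isomorphism class $\lambda$ of finite-dimensional irreducible representations of $G$ fix a unitary representative $\pi^\lambda: G\to U(V_\lambda)$; let $\chi_\lambda$ be its character, $\dim(\lambda)=\dim V_\lambda$, and let $c_2(\lambda)$ be the value on $V_\lambda$ of the quadratic Casimir element determined by the Killing form. For $A>0$ let $$Z_A(g)=\sum_\lambda \chi_\lambda(g)\dim(\lambda)\,e^{-A c_2(\lambda)},\qquad g\in G,$$ be the partition function of two-dimensional Yang–Mills theory on a disc of area $A$ with boundary holonomy $g$. Let $N\ge 1$, read all indices $i\in\{1,\dots,N\}$ cyclically modulo $N$, and let $\pi^{\mu_i}:G\to U(V_{\mu_i})$ be finite-dimensional unitary irreducible representations. For intertwiners $a_i\in \mathrm{Hom}_G(V_{\lambda_i},V_{\lambda_{i-1}}\otimes V_{\mu_i})$ the trace function is $$\Psi_{a,\lambda}(g_1,\dots,g_N)=\mathrm{Tr}\bigl(a_1\pi^{\lambda_1}(g_1)\,a_2\pi^{\lambda_2}(g_2)\cdots a_N\pi^{\lambda_N}(g_N)\bigr)\in V_{\mu_1}\otimes\cdots\otimes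 V_{\mu_N},$$ where $a_i\pi^{\lambda_i}(g_i)$ acts as the identity on the factors $V_{\mu_j}$, $j\neq i$, and the trace is over $V_{\lambda_N}$. The dual trace function is $$\Psi_{\bar a,\lambda}(g_1,\dots,g_N)^*=\mathrm{Tr}\bigl(\bar a_1\pi^{\lambda_1}_*(g_1)\cdots \bar a_N\pi_*^{\lambda_N}(g_N)\bigr)\in V_{\mu_1}^*\otimes\cdots\otimes V_{\mu_N}^*,$$ where $\pi^\lambda_*$ is the representation dual to $\pi^\lambda$ and $\bar a_i:V_{\lambda_i}^*\otimes V_{\mu_i}\to V_{\lambda_{i-1}}^*$ is the partial dual of the Hermitian conjugate $a_i^\dagger$; equivalently $\Psi_{\bar a,\lambda}(g)^*=\langle\Psi_{a,\lambda}(g),\cdot\rangle$. In each space $\mathrm{Hom}_G(V_{\lambda},V_{\lambda'}\otimes V_{\mu_i})$ fix a basis that is orthonormal for the scalar product $(b,a)$ defined by $b^\dagger a=(b,a)\,\mathrm{id}_{V_\lambda}$. For $A_1,\dots,A_N>0$ the multi-time propagator kernel of the $N$-spin Calogero–Moser chain is the operator on $V_{\mu_1}\otimes\cdots\otimes V_{\mu_N}$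 $$U_{A}(g,g')=\sum_{\lambda_1,\dots,\lambda_N}\ \sum_{a_1,\dots,a_N}\exp\Bigl(-\sum_{i=1}^N c_2(\lambda_i)A_i\Bigr)\,\Psi_{a,\lambda}(g_1,\dots,g_N)\,\Psi_{\bar a,\lambda}(g'_1,\dots,g'_N)^*,\qquad g,g'\in G^N,$$ where each $\lambda_i$ runs over the isomorphism classes of irreducible representations and each $a_i$ over the chosen basis of $\mathrm{Hom}_G(V_{\lambda_i},V_{\lambda_{i-1}}\otimes V_{\mu_i})$. Theorem. The series $Z_{A_i}(x)$, $x\in G$, and $U_A(g,g')$ converge (unconditionally), the integrand below is integrable, and for all $g,g'\in G^N$ $$U_A(g,g')=\int_{G^N}\ \prod_{i=1}^N Z_{A_i}\bigl({g_i'}^{-1}h_i^{-1}g_i h_{i+1}\bigr)\ \pi^{\mu_1}(h_1)\otimes\cdots\otimes\pi^{\mu_N}(h_N)\ dh_1\cdots dh_N .$$ -/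

import Mathlib

open scoped Manifold ContDiff Kronecker
open MeasureTheory

noncomputable section

namespace SpinCM

/-- A smooth Lie group is `C^3`; this gives access to the Lie algebra structure on the tangent
space at the identity. -/
instance instLieGroupMinSmoothness {n : ℕ} {G : Type*} [TopologicalSpace G]
    [ChartedSpace (EuclideanSpace ℝ (Fin n)) G] [Group G] [LieGroup (𝓡 n) ∞ G] :
    LieGroup (𝓡 n) (minSmoothness ℝ 3) G :=
  LieGroup.of_le (n := ∞) (by
    rw [minSmoothness_of_isRCLikeNormedField]
    exact WithTop.coe_le_coe.2 (le_top : (3 : ℕ∞) ≤ ⊤))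

section Representations

/-- The representation on `ℂ^d` attached to a homomorphism into the unitary group `U(d)`. -/
def unitaryRep {G : Type*} [Group G] {d : ℕ} (π : G →* Matrix.unitaryGroup (Fin d) ℂ) :
    Representation ℂ G (Fin d → ℂ) :=
  ((Matrix.toLinAlgEquiv' : Matrix (Fin d) (Fin d) ℂ ≃ₐ[ℂ] _) :
      Matrix (Fin d) (Fin d) ℂ →* Module.End ℂ (Fin d → ℂ)).comp
    ((Matrix.unitaryGroup (Fin d) ℂ).subtype.comp π)

variable (n : ℕ) (G : Type*) [TopologicalSpace G]
  [ChartedSpace (EuclideanSpace ℝ (Fin n)) G] [Group G]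

/-- A finite dimensional irreducible unitary (smooth) representation of the Lie group `G`, written
in an orthonormal basis of its space, which is thereby identified with `ℂ^dim`. -/
structure UnitaryIrrep where
  dim : ℕ
  hom : G →* Matrix.unitaryGroup (Fin dim) ℂ
  smooth : ∀ i j, ContMDiff (𝓡 n) 𝓘(ℝ, ℂ) ∞
    (fun g : G => (hom g : Matrix (Fin dim) (Fin dim) ℂ) i j)
  irreducible : (unitaryRep hom).IsIrreducible

/-- Equivalence (isomorphism) of irreducible representations. -/
instance UnitaryIrrep.setoid : Setoid (UnitaryIrrep n G) where
  r V W := Nonempty (Representation.Equiv (unitaryRep V.hom) (unitaryRep W.hom))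
  iseqv :=
    { refl := fun _ => ⟨Representation.Equiv.refl _⟩
      symm := fun ⟨e⟩ => ⟨e.symm⟩
      trans := fun ⟨e⟩ ⟨f⟩ => ⟨e.trans f⟩ }

/-- The set of isomorphism classes of finite dimensional irreducible representations of `G`
(the set of highest weights `λ`). -/
def IrrepClass := Quotient (UnitaryIrrep.setoid n G)

/-- The isomorphism class of an irreducible representation. -/
def UnitaryIrrep.cls {n : ℕ} {G : Type*} [TopologicalSpace G]
    [ChartedSpace (EuclideanSpace ℝ (Fin n)) G] [Group G] (V : UnitaryIrrep n G) :
    IrrepClass n G := Quotient.mk _ V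

variable {n G}

namespace UnitaryIrrep

/-- The matrix `π(g)`. -/
def mat (V : UnitaryIrrep n G) (g : G) : Matrix (Fin V.dim) (Fin V.dim) ℂ := V.hom g

/-- The character `χ(g) = Tr π(g)`. -/
def character (V : UnitaryIrrep n G) (g : G) : ℂ := (V.mat g).trace

/-- The matrix of the dual representation, `π^*(g) = π(g⁻¹)ᵀ`, in the dual basis. -/
def dualMat (V : UnitaryIrrep n G) (g : G) : Matrix (Fin V.dim) (Fin V.dim) ℂ :=
  (V.mat g⁻¹).transpose

/-- The differential `dπ(X)`, `X ∈ 𝔤`, of the representation at the identity. -/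
def lieMat (V : UnitaryIrrep n G) (X : GroupLieAlgebra (𝓡 n) G) :
    Matrix (Fin V.dim) (Fin V.dim) ℂ :=
  Matrix.of fun i j => (mfderiv (𝓡 n) 𝓘(ℝ, ℂ) (fun g : G => V.mat g i j) 1 X : ℂ)

end UnitaryIrrep

variable (n G) in
/-- The standard basis of the Lie algebra `𝔤 = T_1 G`, which as a vector space is `ℝ^n`. -/
def lieBasis (i : Fin n) : GroupLieAlgebra (𝓡 n) G :=
  (EuclideanSpace.basisFun (Fin n) ℝ i : EuclideanSpace ℝ (Fin n))

variable (n G) in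
/-- The Gram matrix of the Killing form of `𝔤` in the standard basis. -/
def killingGram [LieGroup (𝓡 n) ∞ G] : Matrix (Fin n) (Fin n) ℝ :=
  Matrix.of fun i j =>
    killingForm ℝ (GroupLieAlgebra (𝓡 n) G) (lieBasis n G i) (lieBasis n G j)

/-- The action of the quadratic Casimir element `∑ i, X_i X^i` of the universal enveloping algebra,
where `X^i` is the basis dual to `X_i` with respect to the Killing form. -/
def UnitaryIrrep.casimirMat [LieGroup (𝓡 n) ∞ G] (V : UnitaryIrrep n G) :
    Matrix (Fin V.dim) (Fin V.dim) ℂ :=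
  ∑ i, ∑ j, (((killingGram n G)⁻¹ i j : ℝ) : ℂ) •
    (V.lieMat (lieBasis n G i) * V.lieMat (lieBasis n G j))

/-- The value `c_2` of the quadratic Casimir element on an irreducible representation: the real
number by which it acts, read off as its normalized trace. -/
def UnitaryIrrep.c₂ [LieGroup (𝓡 n) ∞ G] (V : UnitaryIrrep n G) : ℝ :=
  (V.casimirMat.trace / (V.dim : ℂ)).re

/-- `Hom_G(V, V' ⊗ U)` in matrix form; rows are indexed by the product basis of `V' ⊗ U`. -/
def Intertwiner (V V' U : UnitaryIrrep n G) :
    Submodule ℂ (Matrix (Fin V'.dim × Fin U.dim) (Fin V.dim) ℂ) where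
  carrier := {a | ∀ g : G, (V'.mat g ⊗ₖ U.mat g) * a = a * V.mat g}
  add_mem' := by
    intro a b ha hb g
    rw [Matrix.mul_add, Matrix.add_mul, ha g, hb g]
  zero_mem' := by
    intro g
    simp
  smul_mem' := by
    intro c a ha g
    rw [Matrix.mul_smul, Matrix.smul_mul, ha g]

/-- The number of elements of a basis of `Hom_G(V, V' ⊗ U)`. -/
abbrev multiplicity (V V' U : UnitaryIrrep n G) : ℕ := Module.finrank ℂ (Intertwiner V V' U)

/-- For `a ∈ Hom_G(V, V' ⊗ U)`, the partial dual `ā : V^* ⊗ U → V'^*` of the Hermitian conjugate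
`a^† : V' ⊗ U → V`. -/
def dualVertex {V V' U : UnitaryIrrep n G} (a : Intertwiner V V' U) :
    Matrix (Fin V'.dim) (Fin V.dim × Fin U.dim) ℂ :=
  Matrix.of fun p q => (a : Matrix _ _ ℂ).conjTranspose q.1 (p, q.2)

/-- The component `V → V'` of `a : V → V' ⊗ U` along the `s`-th basis vector of `U`. -/
def vertexComponent {V V' U : UnitaryIrrep n G} (a : Intertwiner V V' U) (s : Fin U.dim) :
    Matrix (Fin V'.dim) (Fin V.dim) ℂ :=
  Matrix.of fun p q => a.1 (p, s) q

/-- The map `V^* → V'^*` obtained by inserting the `s`-th basis vector of `U` into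
`ā : V^* ⊗ U → V'^*`. -/
def dualVertexComponent {V V' U : UnitaryIrrep n G} (a : Intertwiner V V' U) (s : Fin U.dim) :
    Matrix (Fin V'.dim) (Fin V.dim) ℂ :=
  Matrix.of fun p q => dualVertex a p (q, s)

theorem UnitaryIrrep.dualMat_apply (V : UnitaryIrrep n G) (x : G) (q r : Fin V.dim) :
    V.dualMat x q r = star (V.mat x q r) := by
  simp only [UnitaryIrrep.dualMat, UnitaryIrrep.mat, map_inv, Matrix.transpose_apply]
  rfl

theorem dual_step_apply {V V' U : UnitaryIrrep n G} (a : Intertwiner V V' U) (s : Fin U.dim)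
    (x : G) (p : Fin V'.dim) (r : Fin V.dim) :
    (dualVertexComponent a s * V.dualMat x) p r = star ((vertexComponent a s * V.mat x) p r) := by
  rw [Matrix.mul_apply, Matrix.mul_apply, star_sum]
  refine Finset.sum_congr rfl fun q _ => ?_
  rw [star_mul', V.dualMat_apply]
  rfl

end Representations

section TraceFunctions

/-- The trace `Tr(M_1 M_2 ⋯ M_N)` of a closed chain of linear maps `M_i : W_i → W_{i-1}`,
`i` cyclic modulo `N`, given by rectangular matrices. -/
def cyclicTrace {N : ℕ} [NeZero N] {d : Fin N → ℕ}
    (M : ∀ i : Fin N, Matrix (Fin (d (i - 1))) (Fin (d i)) ℂ) : ℂ :=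
  ∑ p : ∀ i, Fin (d i), ∏ i, M i (p (i - 1)) (p i)

variable {n : ℕ} {G : Type*} [TopologicalSpace G]
  [ChartedSpace (EuclideanSpace ℝ (Fin n)) G] [Group G] {N : ℕ}

/-- The product basis of `V_{μ_1} ⊗ ⋯ ⊗ V_{μ_N}`. -/
abbrev TensorIndex (μ : Fin N → UnitaryIrrep n G) : Type := ∀ i, Fin (μ i).dim

/-- The operator `π^{μ_1}(h_1) ⊗ ⋯ ⊗ π^{μ_N}(h_N)`. -/
def tensorRep (μ : Fin N → UnitaryIrrep n G) (h : Fin N → G) :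
    Matrix (TensorIndex μ) (TensorIndex μ) ℂ :=
  Matrix.of fun s t => ∏ i, (μ i).mat (h i) (s i) (t i)

variable [NeZero N]

/-- The trace function `Ψ(g_1, …, g_N) = Tr(a_1 π(g_1) a_2 π(g_2) ⋯ a_N π(g_N))`, a vector in
`V_{μ_1} ⊗ ⋯ ⊗ V_{μ_N}`, where `a_i : V_{λ_i} → V_{λ_{i-1}} ⊗ V_{μ_i}`. -/
def traceFunction (μ lam : Fin N → UnitaryIrrep n G)
    (a : ∀ i, Intertwiner (lam i) (lam (i - 1)) (μ i)) (g : Fin N → G) : TensorIndex μ → ℂ :=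
  fun s => cyclicTrace (d := fun i => (lam i).dim) fun i =>
    vertexComponent (a i) (s i) * (lam i).mat (g i)

/-- The dual trace function `Ψ(g)^* = Tr(ā_1 π^*(g_1) ā_2 π^*(g_2) ⋯ ā_N π^*(g_N))`, a vector in
`V_{μ_1}^* ⊗ ⋯ ⊗ V_{μ_N}^*`; the trace is over a closed chain of the dual spaces `V_{λ_i}^*`. -/
def dualTraceFunction (μ lam : Fin N → UnitaryIrrep n G)
    (a : ∀ i, Intertwiner (lam i) (lam (i - 1)) (μ i)) (g : Fin N → G) : TensorIndex μ → ℂ :=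
  fun s => cyclicTrace (d := fun i => (lam i).dim) fun i =>
    dualVertexComponent (a i) (s i) * (lam i).dualMat (g i)

/-- The dual trace function is the functional `⟨Ψ(g), ·⟩`. -/
theorem dualTraceFunction_eq_star (μ lam : Fin N → UnitaryIrrep n G)
    (a : ∀ i, Intertwiner (lam i) (lam (i - 1)) (μ i)) (g : Fin N → G) :
    dualTraceFunction μ lam a g = star (traceFunction μ lam a g) := by
  funext s
  simp only [dualTraceFunction, traceFunction, cyclicTrace, Pi.star_apply, star_sum, star_prod]
  exact Finset.sum_congr rfl fun p _ => Finset.prod_congr rfl fun i _ => dual_step_apply _ _ _ _ _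

end TraceFunctions

section Propagator

variable {n : ℕ} {G : Type*} [TopologicalSpace G]
  [ChartedSpace (EuclideanSpace ℝ (Fin n)) G] [Group G] {N : ℕ} [NeZero N]

/-- A choice of a basis `{a}` of `Hom_G(V_λ, V_{λ'} ⊗ V_{μ_i})` for all `i`, `λ`, `λ'`. -/
abbrev VertexBases (V : IrrepClass n G → UnitaryIrrep n G) (μ : Fin N → UnitaryIrrep n G) :=
  ∀ (i : Fin N) (lam lam' : IrrepClass n G),
    Module.Basis (Fin (multiplicity (V lam) (V lam') (μ i))) ℂ
      (Intertwiner (V lam) (V lam') (μ i))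

/-- The bases are orthonormal for the scalar products `(b, a)` on `Hom_G(V_λ, V_{λ'} ⊗ V_{μ_i})`
given by `b^† a = (b, a) id`. -/
def VertexBases.IsOrthonormal {V : IrrepClass n G → UnitaryIrrep n G}
    {μ : Fin N → UnitaryIrrep n G} (a : VertexBases V μ) : Prop :=
  ∀ (i : Fin N) (lam lam' : IrrepClass n G) (k l : Fin (multiplicity (V lam) (V lam') (μ i))),
    (a i lam lam' k).1.conjTranspose * (a i lam lam' l).1 = if k = l then 1 else 0

/-- The summation labels `({λ}, {a})`. -/
abbrev SpectralLabel (V : IrrepClass n G → UnitaryIrrep n G) (μ : Fin N → UnitaryIrrep n G) :=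
  Σ lam : Fin N → IrrepClass n G,
    ∀ i, Fin (multiplicity (V (lam i)) (V (lam (i - 1))) (μ i))

variable [LieGroup (𝓡 n) ∞ G]

/-- The summand `exp(-∑ c_2(λ_i) A_i) Ψ(g) Ψ(g')^*` of the propagator, as an operator on
`V_{μ_1} ⊗ ⋯ ⊗ V_{μ_N}`. -/
def propagatorTerm (V : IrrepClass n G → UnitaryIrrep n G) (μ : Fin N → UnitaryIrrep n G)
    (a : VertexBases V μ) (A : Fin N → ℝ) (g g' : Fin N → G) (x : SpectralLabel V μ) :
    Matrix (TensorIndex μ) (TensorIndex μ) ℂ :=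
  ((Real.exp (-∑ i, (V (x.1 i)).c₂ * A i) : ℝ) : ℂ) •
    Matrix.vecMulVec
      (traceFunction μ (fun i => V (x.1 i)) (fun i => a i (x.1 i) (x.1 (i - 1)) (x.2 i)) g)
      (dualTraceFunction μ (fun i => V (x.1 i)) (fun i => a i (x.1 i) (x.1 (i - 1)) (x.2 i)) g')

/-- The kernel of the multi-time propagator for the quadratic Hamiltonians. -/
def propagatorKernel (V : IrrepClass n G → UnitaryIrrep n G) (μ : Fin N → UnitaryIrrep n G)
    (a : VertexBases V μ) (A : Fin N → ℝ) (g g' : Fin N → G) :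
    Matrix (TensorIndex μ) (TensorIndex μ) ℂ :=
  ∑' x : SpectralLabel V μ, propagatorTerm V μ a A g g' x

/-- The summand `χ_λ(g) dim(λ) exp(-A c_2(λ))`. -/
def discTerm (V : UnitaryIrrep n G) (A : ℝ) (g : G) : ℂ :=
  V.character g * (V.dim : ℂ) * ((Real.exp (-A * V.c₂) : ℝ) : ℂ)

/-- The two-dimensional Yang–Mills partition function `Z_A(g)` of a disc of area `A` with boundary
holonomy `g`. -/
def discPartition (V : IrrepClass n G → UnitaryIrrep n G) (A : ℝ) (g : G) : ℂ :=
  ∑' lam : IrrepClass n G, discTerm (V lam) A g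

/-- The integrand of the cylinder integral: the product of the disc partition functions of the
`N` strips times the holonomies along the `N` open Wilson lines. -/
def cylinderIntegrand (V : IrrepClass n G → UnitaryIrrep n G) (μ : Fin N → UnitaryIrrep n G)
    (A : Fin N → ℝ) (g g' h : Fin N → G) : Matrix (TensorIndex μ) (TensorIndex μ) ℂ :=
  (∏ i, discPartition V (A i) ((g' i)⁻¹ * (h i)⁻¹ * g i * h (i + 1))) • tensorRep μ h

end Propagator

end SpinCM

end

/-!
For fixed representations `λ_1, …, λ_N`, expand every character
`χ_{λ_i}(g_i'⁻¹ h_i⁻¹ g_i h_{i+1})` in matrix coefficients. The variable `h_i` then occurs in one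
coefficient of each of `λ_{i-1}`, `μ_i` and the conjugate of `λ_i`, so that by Fubini the integral over
`G^N` splits into averages of three coefficients. Such an average is an entry of the orthogonal
projection onto `Hom_G(V_{λ_i}, V_{λ_{i-1}} ⊗ V_{μ_i})`, which an orthonormal basis of intertwiners
expresses as `dim(λ_i)⁻¹ ∑ a ⊗ a^†` (`integral_vertex`). The factors `dim(λ_i)` of the disc functions
cancel, and what is left is the product of trace functions (`integral_prod_character_strip`,
`sum_propagatorTerm`).

Exchanging the sums with the integral rests on `∑ dim(λ)² exp(-A c₂(λ)) < ∞`
(`summable_dim_sq_mul_exp_neg_casimir`), which is proved here without highest weights.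

* The differential of every unitary representation is a Lie algebra homomorphism into skew-Hermitian
  matrices (`UnitaryIrrep.dRep_bracket`, `UnitaryIrrep.conjTranspose_dRep`). If one of these
  differentials is nonzero, it is injective by simplicity, so its trace form is an invariant inner
  product on `𝔤`, the operators `ad X` are skew and the Killing form is negative definite
  (`killingForm_self_neg`). Hence `c₂` dominates a multiple of `∑ ‖dπ(X_k)‖² / dim`
  (`exists_pos_mul_energy_le`); if all differentials vanish this is trivial.
* In the chart at the identity, `π` is Lipschitz with a constant proportional to the square root of
  `∑ ‖dπ(X_k)‖²`, uniformly in `π` (`exists_lipschitz_chart`).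
* For a finite set `S` of representations, `f = ∑_{λ ∈ S} dim(λ) χ_λ` satisfies
  `∫ |f|² = f(1) = ∑_{λ ∈ S} dim(λ)²` by the orthogonality relations, whereas `|f| ≥ f(1) / 2` wherever
  every `π^λ` is close to `1`. So `f(1)` is at most `4` over the measure of that set
  (`sum_dim_sq_mul_measureReal_nearOne_le`). A subdivision of a chart cube bounds this measure below by
  a power of the spectral cutoff (`exists_measureReal_nearOne_ge`), so the dimensions grow
  polynomially and the exponential weights win.
-/

noncomputable section

set_option linter.unusedSectionVars false

namespace SpinCM

/-! ### Averaging over a compact group -/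

section Averaging

open Matrix

variable {G : Type*} [TopologicalSpace G] [Group G] [MeasurableSpace G]
  {ι κ : Type*} [Fintype ι] [DecidableEq ι] [Fintype κ] [DecidableEq κ]

/-- The average `∫ ρ(h) X π(h)^† dh` of a matrix `X` over the group, taken entrywise. -/
def haarAverage (ν : Measure G) (ρ : G → Matrix ι ι ℂ) (π : G → Matrix κ κ ℂ)
    (X : Matrix ι κ ℂ) : Matrix ι κ ℂ :=
  Matrix.of fun p q => ∫ h, (ρ h * X * (π h)ᴴ) p q ∂ν

variable [CompactSpace G] [BorelSpace G]
  (ν : Measure G) [IsFiniteMeasure ν]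

theorem integrable_of_continuous_of_compactSpace {f : G → ℂ} (hf : Continuous f) :
    Integrable f ν :=
  (integrableOn_univ).1 (hf.continuousOn.integrableOn_compact' isCompact_univ MeasurableSet.univ)

variable {ρ : G →* Matrix ι ι ℂ} {π : G →* Matrix κ κ ℂ}

theorem continuous_conj_entry (hρ : Continuous ρ) (hπ : Continuous π) (X : Matrix ι κ ℂ)
    (p : ι) (q : κ) : Continuous fun h => (ρ h * X * (π h)ᴴ) p q :=
  ((hρ.matrix_mul continuous_const).matrix_mul hπ.matrix_conjTranspose).matrix_elem p q

theorem mul_haarAverage_mul (hρ : Continuous ρ) (hπ : Continuous π) (X : Matrix ι κ ℂ)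
    {m l : Type*} [Fintype m] [Fintype l] (B : Matrix m ι ℂ) (C : Matrix κ l ℂ) (p : m) (q : l) :
    (B * haarAverage ν ρ π X * C) p q = ∫ h, (B * (ρ h * X * (π h)ᴴ) * C) p q ∂ν := by
  have hi : ∀ i j, Integrable (fun h => (ρ h * X * (π h)ᴴ) i j) ν := fun i j =>
    integrable_of_continuous_of_compactSpace ν (continuous_conj_entry hρ hπ X i j)
  have e : ∀ Y : Matrix ι κ ℂ, (B * Y * C) p q = ∑ j, ∑ i, B p i * Y i j * C j q := fun Y => by
    rw [Matrix.mul_apply]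
    exact Finset.sum_congr rfl fun j _ => by rw [Matrix.mul_apply, Finset.sum_mul]
  simp only [e]
  rw [integral_finsetSum _ fun j _ => integrable_finsetSum _ fun i _ =>
    ((hi i j).const_mul _).mul_const _]
  refine Finset.sum_congr rfl fun j _ => ?_
  rw [integral_finsetSum _ fun i _ => ((hi i j).const_mul _).mul_const _]
  refine Finset.sum_congr rfl fun i _ => ?_
  rw [integral_mul_const, integral_const_mul]
  rfl

/-- The average is an intertwiner. -/
theorem haarAverage_intertwines [IsTopologicalGroup G] [ν.IsMulLeftInvariant]
    (hρ : Continuous ρ) (hπ : Continuous π) (hu : ∀ g, π g⁻¹ = (π g)ᴴ) (X : Matrix ι κ ℂ) (g : G) :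
    ρ g * haarAverage ν ρ π X = haarAverage ν ρ π X * π g := by
  have key : ρ g * haarAverage ν ρ π X * (π g)ᴴ = haarAverage ν ρ π X := by
    ext p q
    rw [mul_haarAverage_mul ν hρ hπ]
    have := integral_mul_left_eq_self (μ := ν) (fun h => (ρ h * X * (π h)ᴴ) p q) g
    rw [haarAverage, Matrix.of_apply, ← this]
    congr 1
    funext h
    simp only [map_mul, Matrix.conjTranspose_mul, Matrix.mul_assoc]
  have hg : (π g)ᴴ * π g = 1 := by rw [← hu, ← map_mul, inv_mul_cancel, map_one]
  calc ρ g * haarAverage ν ρ π X = ρ g * haarAverage ν ρ π X * ((π g)ᴴ * π g) := by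
        rw [hg, Matrix.mul_one]
    _ = _ := by rw [← Matrix.mul_assoc, key]

/-- Averaging does not change the scalar product with an intertwiner. -/
theorem trace_conjTranspose_mul_haarAverage [IsProbabilityMeasure ν]
    (hρ : Continuous ρ) (hπ : Continuous π) (huρ : ∀ g, ρ g⁻¹ = (ρ g)ᴴ)
    (hu : ∀ g, π g⁻¹ = (π g)ᴴ) (X a : Matrix ι κ ℂ) (ha : ∀ g, ρ g * a = a * π g) :
    (aᴴ * haarAverage ν ρ π X).trace = (aᴴ * X).trace := by
  have hi : ∀ i, Integrable (fun h => (aᴴ * (ρ h * X * (π h)ᴴ) * (1 : Matrix κ κ ℂ)) i i) ν :=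
    fun i => integrable_of_continuous_of_compactSpace ν
      (((continuous_const.matrix_mul ((hρ.matrix_mul continuous_const).matrix_mul
        hπ.matrix_conjTranspose)).matrix_mul continuous_const).matrix_elem i i)
  have h1 : (aᴴ * haarAverage ν ρ π X).trace
      = ∫ h, (aᴴ * (ρ h * X * (π h)ᴴ)).trace ∂ν := by
    simp only [Matrix.trace, Matrix.diag]
    have e : ∀ h, ∑ i, (aᴴ * (ρ h * X * (π h)ᴴ)) i i
        = ∑ i, (aᴴ * (ρ h * X * (π h)ᴴ) * (1 : Matrix κ κ ℂ)) i i := by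
      intro h; rw [Matrix.mul_one]
    simp only [e]
    rw [integral_finsetSum _ fun i _ => hi i]
    refine Finset.sum_congr rfl fun i _ => ?_
    rw [← mul_haarAverage_mul ν hρ hπ, Matrix.mul_one]
  have h2 : ∀ h, (aᴴ * (ρ h * X * (π h)ᴴ)).trace = (aᴴ * X).trace := by
    intro h
    have e : aᴴ * ρ h = π h * aᴴ := by
      have := congrArg conjTranspose (ha h⁻¹)
      rw [conjTranspose_mul, conjTranspose_mul, huρ, hu, conjTranspose_conjTranspose,
        conjTranspose_conjTranspose] at this
      exact this
    have hg : (π h)ᴴ * π h = 1 := by rw [← hu, ← map_mul, inv_mul_cancel, map_one]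
    rw [Matrix.mul_assoc (ρ h), ← Matrix.mul_assoc, e, ← Matrix.mul_assoc, Matrix.trace_mul_comm,
      Matrix.mul_assoc (π h), ← Matrix.mul_assoc, hg, Matrix.one_mul]
  rw [h1]
  simp [h2]

/-- Matrix coefficients integrate to the entries of the average of a matrix unit. -/
theorem integral_mul_star_eq_haarAverage (p p' : ι) (q q' : κ) :
    ∫ h, ρ h p p' * star (π h q q') ∂ν
      = haarAverage ν ρ π (Matrix.single p' q' 1) p q := by
  rw [haarAverage, Matrix.of_apply]
  congr 1
  funext h
  rw [Matrix.mul_apply, Finset.sum_eq_single q']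
  · simp [Matrix.mul_single_apply_same, Matrix.conjTranspose_apply]
  · intro b _ hb
    rw [Matrix.mul_single_apply_of_ne _ _ _ _ _ hb, zero_mul]
  · simp

end Averaging

/-! ### Irreducible representations and the orthogonality relations -/

section Schur

open Matrix

variable {n : ℕ} {G : Type*} [TopologicalSpace G]
  [ChartedSpace (EuclideanSpace ℝ (Fin n)) G] [Group G]

namespace UnitaryIrrep

/-- The matrices `π(g)` as a homomorphism into the multiplicative monoid of matrices. -/
def matHom (V : UnitaryIrrep n G) : G →* Matrix (Fin V.dim) (Fin V.dim) ℂ :=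
  (Matrix.unitaryGroup (Fin V.dim) ℂ).subtype.comp V.hom

@[simp] theorem matHom_apply (V : UnitaryIrrep n G) (g : G) : V.matHom g = V.mat g := rfl

@[simp] theorem mat_one (V : UnitaryIrrep n G) : V.mat 1 = 1 := map_one V.matHom

theorem mat_mul (V : UnitaryIrrep n G) (g h : G) : V.mat (g * h) = V.mat g * V.mat h :=
  map_mul V.matHom g h

theorem mat_inv (V : UnitaryIrrep n G) (g : G) : V.mat g⁻¹ = (V.mat g)ᴴ := by
  simp only [UnitaryIrrep.mat, map_inv]
  rfl

theorem mat_mul_conjTranspose (V : UnitaryIrrep n G) (g : G) : V.mat g * (V.mat g)ᴴ = 1 := by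
  rw [← mat_inv, ← mat_mul, mul_inv_cancel, mat_one]

theorem conjTranspose_mul_mat (V : UnitaryIrrep n G) (g : G) : (V.mat g)ᴴ * V.mat g = 1 := by
  rw [← mat_inv, ← mat_mul, inv_mul_cancel, mat_one]

theorem continuous_mat (V : UnitaryIrrep n G) : Continuous V.mat :=
  continuous_matrix fun i j => (V.smooth i j).continuous

theorem dim_pos (V : UnitaryIrrep n G) : 0 < V.dim := by
  have := V.irreducible
  obtain ⟨x, y, hxy⟩ := (inferInstance : Nontrivial (Subrepresentation (unitaryRep V.hom)))
  rcases Nat.eq_zero_or_pos V.dim with h | h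
  · exfalso
    apply hxy
    have : IsEmpty (Fin V.dim) := by rw [h]; infer_instance
    exact Subrepresentation.toSubmodule_injective (Subsingleton.elim _ _)
  · exact h

end UnitaryIrrep

/-- A matrix commuting with the group actions, as a morphism of representations. -/
def intertwiningMapOfMatrix {V W : UnitaryIrrep n G} (X : Matrix (Fin W.dim) (Fin V.dim) ℂ)
    (hX : ∀ g, W.mat g * X = X * V.mat g) :
    Representation.IntertwiningMap (unitaryRep V.hom) (unitaryRep W.hom) :=
  LinearMap.intertwiningMap_of_isIntertwiningMap _ _ (Matrix.toLin' X) fun g v => by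
    have : W.mat g *ᵥ (X *ᵥ v) = X *ᵥ (V.mat g *ᵥ v) := by
      rw [Matrix.mulVec_mulVec, Matrix.mulVec_mulVec, hX]
    exact this.symm

/-- Schur's lemma for inequivalent representations. -/
theorem intertwiner_eq_zero {V W : UnitaryIrrep n G} (h : V.cls ≠ W.cls)
    (X : Matrix (Fin W.dim) (Fin V.dim) ℂ) (hX : ∀ g, W.mat g * X = X * V.mat g) : X = 0 := by
  have := V.irreducible
  have := W.irreducible
  rcases Representation.IsIrreducible.bijective_or_eq_zero (intertwiningMapOfMatrix X hX)
    with hb | h0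
  · have he : Nonempty (Representation.Equiv (unitaryRep V.hom) (unitaryRep W.hom)) :=
      ⟨(intertwiningMapOfMatrix X hX).ofBijective hb⟩
    exact absurd (Quotient.sound he) h
  · have : Matrix.toLin' X = 0 := congrArg (fun f => f.toLinearMap) h0
    exact (LinearEquiv.map_eq_zero_iff _).1 this

/-- Schur's lemma for a single representation. -/
theorem intertwiner_eq_smul_one {V : UnitaryIrrep n G}
    (X : Matrix (Fin V.dim) (Fin V.dim) ℂ) (hX : ∀ g, V.mat g * X = X * V.mat g) :
    ∃ c : ℂ, X = c • 1 := by
  have := V.irreducible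
  obtain ⟨c, hc⟩ := (Representation.IsIrreducible.algebraMap_intertwiningMap_bijective_of_isAlgClosed
    (ρ := unitaryRep V.hom)).2 (intertwiningMapOfMatrix X hX)
  refine ⟨c, ?_⟩
  have : Matrix.toLin' X = Matrix.toLin' (c • 1) := by
    have h2 := congrArg (fun f => f.toLinearMap) hc
    rw [map_smul, Matrix.toLin'_one]
    exact h2.symm
  exact Matrix.toLin'.injective this

variable [CompactSpace G] [MeasurableSpace G] [BorelSpace G] [IsTopologicalGroup G]
  (ν : Measure G) [ν.IsMulLeftInvariant] [IsProbabilityMeasure ν]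

theorem integral_mat_mul_star_of_ne {V W : UnitaryIrrep n G} (h : V.cls ≠ W.cls)
    (p p' : Fin W.dim) (q q' : Fin V.dim) :
    ∫ h, W.mat h p p' * star (V.mat h q q') ∂ν = 0 := by
  have := integral_mul_star_eq_haarAverage ν (ρ := W.matHom) (π := V.matHom) p p' q q'
  rw [intertwiner_eq_zero h _ (haarAverage_intertwines ν (ρ := W.matHom) (π := V.matHom)
    W.continuous_mat V.continuous_mat V.mat_inv _)] at this
  exact this

theorem integral_mat_mul_star_self (V : UnitaryIrrep n G) (p p' q q' : Fin V.dim) :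
    ∫ h, V.mat h p p' * star (V.mat h q q') ∂ν
      = if p = q ∧ p' = q' then (V.dim : ℂ)⁻¹ else 0 := by
  have h1 := integral_mul_star_eq_haarAverage ν (ρ := V.matHom) (π := V.matHom) p p' q q'
  obtain ⟨c, hc⟩ := intertwiner_eq_smul_one _ (haarAverage_intertwines ν
    V.continuous_mat V.continuous_mat V.mat_inv (Matrix.single p' q' 1) (ρ := V.matHom)
    (π := V.matHom))
  have h2 := trace_conjTranspose_mul_haarAverage ν (ρ := V.matHom) (π := V.matHom)
    V.continuous_mat V.continuous_mat V.mat_inv V.mat_inv (Matrix.single p' q' 1) 1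
    (by intro g; rw [Matrix.mul_one, Matrix.one_mul])
  rw [hc, conjTranspose_one, Matrix.one_mul, Matrix.one_mul, Matrix.trace_smul, Matrix.trace_one,
    Fintype.card_fin] at h2
  rw [hc] at h1
  have hd : (V.dim : ℂ) ≠ 0 := by exact_mod_cast V.dim_pos.ne'
  have h3 : c = if p' = q' then (V.dim : ℂ)⁻¹ else 0 := by
    split_ifs with hpq
    · subst hpq
      rw [Matrix.trace_single_eq_same, smul_eq_mul] at h2
      exact eq_inv_of_mul_eq_one_left h2
    · rw [Matrix.trace_single_eq_of_ne _ _ _ hpq, smul_eq_mul] at h2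
      exact (mul_eq_zero.1 h2).resolve_right hd
  simp only [UnitaryIrrep.matHom_apply] at h1
  rw [h1, Matrix.smul_apply, Matrix.one_apply, h3]
  by_cases h4 : p = q <;> by_cases h5 : p' = q' <;> simp [h4, h5]

theorem integrable_mat_mul_star (V W : UnitaryIrrep n G)
    (p p' : Fin W.dim) (q q' : Fin V.dim) :
    Integrable (fun h => W.mat h p p' * star (V.mat h q q')) ν :=
  integrable_of_continuous_of_compactSpace ν
    ((W.continuous_mat.matrix_elem p p').mul (V.continuous_mat.matrix_elem q q').star)

theorem integral_character_mul_star (V W : UnitaryIrrep n G) :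
    ∫ h, W.character h * star (V.character h) ∂ν
      = ∑ p, ∑ q, ∫ h, W.mat h p p * star (V.mat h q q) ∂ν := by
  simp only [UnitaryIrrep.character, Matrix.trace, Matrix.diag, star_sum, Finset.sum_mul_sum]
  rw [integral_finsetSum _ fun p _ => integrable_finsetSum _ fun q _ =>
    integrable_mat_mul_star ν V W p p q q]
  exact Finset.sum_congr rfl fun p _ => integral_finsetSum _ fun q _ =>
    integrable_mat_mul_star ν V W p p q q

theorem integral_character_mul_star_of_ne {V W : UnitaryIrrep n G} (h : V.cls ≠ W.cls) :
    ∫ h, W.character h * star (V.character h) ∂ν = 0 := by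
  rw [integral_character_mul_star]
  exact Finset.sum_eq_zero fun p _ => Finset.sum_eq_zero fun q _ =>
    integral_mat_mul_star_of_ne ν h _ _ _ _

theorem integral_character_mul_star_self (V : UnitaryIrrep n G) :
    ∫ h, V.character h * star (V.character h) ∂ν = 1 := by
  have hd : (V.dim : ℂ) ≠ 0 := by exact_mod_cast V.dim_pos.ne'
  rw [integral_character_mul_star]
  simp only [integral_mat_mul_star_self, and_self]
  simp [hd]

/-- The average of a product of three matrix coefficients, expanded in an orthonormal basis of
intertwiners. As `a^† a = 1`, each basis element has Hilbert–Schmidt norm `√dim(V)`, which accounts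
for the factor `dim(V)⁻¹`. -/
theorem integral_vertex (V V' U : UnitaryIrrep n G) {m : ℕ}
    (a : Module.Basis (Fin m) ℂ (Intertwiner V V' U))
    (ha : ∀ k l, (a k).1ᴴ * (a l).1 = if k = l then 1 else 0)
    (p p' : Fin V'.dim) (s t : Fin U.dim) (q q' : Fin V.dim) :
    ∫ h, V'.mat h p p' * U.mat h s t * star (V.mat h q q') ∂ν
      = (V.dim : ℂ)⁻¹ * ∑ k, (a k).1 (p, s) q * star ((a k).1 (p', t) q') := by
  let ρ : G →* Matrix (Fin V'.dim × Fin U.dim) (Fin V'.dim × Fin U.dim) ℂ :=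
    { toFun := fun g => V'.mat g ⊗ₖ U.mat g
      map_one' := by simp
      map_mul' := fun g h => by simp only [UnitaryIrrep.mat_mul, Matrix.mul_kronecker_mul] }
  have hρ : Continuous ρ := continuous_matrix fun i j =>
    (V'.continuous_mat.matrix_elem _ _).mul (U.continuous_mat.matrix_elem _ _)
  have huρ : ∀ g, ρ g⁻¹ = (ρ g)ᴴ := fun g => by
    change V'.mat g⁻¹ ⊗ₖ U.mat g⁻¹ = (V'.mat g ⊗ₖ U.mat g)ᴴ
    rw [V'.mat_inv, U.mat_inv, Matrix.conjTranspose_kronecker]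
  have h1 := integral_mul_star_eq_haarAverage ν (ρ := ρ) (π := V.matHom) (p, s) (p', t) q q'
  set P := haarAverage ν ρ V.matHom (Matrix.single (p', t) q' 1) with hP
  have hmem : P ∈ Intertwiner V V' U := fun g =>
    haarAverage_intertwines ν hρ V.continuous_mat V.mat_inv _ g
  have hsum : ∑ k, a.repr ⟨P, hmem⟩ k • (a k).1 = P := by
    have := congrArg (Intertwiner V V' U).subtype (a.sum_repr ⟨P, hmem⟩)
    rw [map_sum] at this
    exact this
  have hd : (V.dim : ℂ) ≠ 0 := by exact_mod_cast V.dim_pos.ne'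
  have hc : ∀ k, a.repr ⟨P, hmem⟩ k = (V.dim : ℂ)⁻¹ * star ((a k).1 (p', t) q') := by
    intro k
    have h2 := trace_conjTranspose_mul_haarAverage ν (ρ := ρ) (π := V.matHom)
      hρ V.continuous_mat huρ V.mat_inv (Matrix.single (p', t) q' 1) (a k).1 (fun g => (a k).2 g)
    have h3 : ((a k).1ᴴ * P).trace = a.repr ⟨P, hmem⟩ k * V.dim := by
      conv_lhs => rw [← hsum]
      rw [Matrix.mul_sum, Matrix.trace_sum, Finset.sum_eq_single k]
      · rw [Matrix.mul_smul, ha, if_pos rfl, Matrix.trace_smul, Matrix.trace_one,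
          Fintype.card_fin, smul_eq_mul]
      · intro b _ hb
        rw [Matrix.mul_smul, ha, if_neg hb.symm, smul_zero, Matrix.trace_zero]
      · simp
    have h5 : ((a k).1ᴴ * Matrix.single (p', t) q' (1 : ℂ)).trace = star ((a k).1 (p', t) q') := by
      rw [Matrix.trace_mul_single]
      simp [Matrix.conjTranspose_apply]
    rw [← hP, h3, h5] at h2
    rw [← h2]
    field_simp
  have h4 : P (p, s) q = ∑ k, a.repr ⟨P, hmem⟩ k * (a k).1 (p, s) q := by
    conv_lhs => rw [← hsum]
    simp [Matrix.sum_apply]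
  calc ∫ h, V'.mat h p p' * U.mat h s t * star (V.mat h q q') ∂ν = P (p, s) q := h1
    _ = _ := by
      rw [h4, Finset.mul_sum]
      refine Finset.sum_congr rfl fun k _ => ?_
      rw [hc]; ring

end Schur

/-! ### Differentials of representations and a uniform Lipschitz bound -/

section HilbertSchmidt

open Matrix

variable {ι κ : Type*} [Fintype ι] [Fintype κ]

/-- The square of the Hilbert–Schmidt norm of a complex matrix. -/
def hsNormSq (M : Matrix ι κ ℂ) : ℝ := ∑ i, ∑ j, ‖M i j‖ ^ 2

theorem hsNormSq_nonneg (M : Matrix ι κ ℂ) : 0 ≤ hsNormSq M :=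
  Finset.sum_nonneg fun _ _ => Finset.sum_nonneg fun _ _ => sq_nonneg _

theorem hsNormSq_eq_trace (M : Matrix ι κ ℂ) : (hsNormSq M : ℂ) = (Mᴴ * M).trace := by
  rw [Matrix.trace, hsNormSq, Finset.sum_comm]
  push_cast
  refine Finset.sum_congr rfl fun j _ => ?_
  rw [Matrix.diag_apply, Matrix.mul_apply]
  refine Finset.sum_congr rfl fun i _ => ?_
  rw [Matrix.conjTranspose_apply, RCLike.star_def, Complex.conj_mul']

theorem hsNormSq_mul_of_conjTranspose_mul_self [DecidableEq ι] {U : Matrix ι ι ℂ}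
    (hU : Uᴴ * U = 1) (M : Matrix ι κ ℂ) : hsNormSq (U * M) = hsNormSq M := by
  have : (hsNormSq (U * M) : ℂ) = hsNormSq M := by
    rw [hsNormSq_eq_trace, hsNormSq_eq_trace, Matrix.conjTranspose_mul, Matrix.mul_assoc,
      ← Matrix.mul_assoc Uᴴ, hU, Matrix.one_mul]
  exact_mod_cast this

theorem norm_sum_star_mul_le (A B : Matrix ι κ ℂ) :
    ‖∑ i, ∑ j, star (A i j) * B i j‖ ≤ √(hsNormSq A) * √(hsNormSq B) := by
  rw [← Real.sqrt_mul (hsNormSq_nonneg A)]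
  refine (norm_sum_le _ _).trans ?_
  refine (Finset.sum_le_sum fun i _ => norm_sum_le _ _).trans ?_
  apply Real.le_sqrt_of_sq_le
  simp only [hsNormSq, norm_mul, norm_star, ← Fintype.sum_prod_type']
  exact Finset.sum_mul_sq_le_sq_mul_sq _ _ _

theorem hsNormSq_sum_smul_le {m : ℕ} (c : EuclideanSpace ℝ (Fin m))
    (L : Fin m → Matrix ι κ ℂ) :
    hsNormSq (∑ k, ((c k : ℝ) : ℂ) • L k) ≤ ‖c‖ ^ 2 * ∑ k, hsNormSq (L k) := by
  have h : ∀ i j, ‖(∑ k, ((c k : ℝ) : ℂ) • L k) i j‖ ^ 2 ≤ ‖c‖ ^ 2 * ∑ k, ‖L k i j‖ ^ 2 := by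
    intro i j
    rw [EuclideanSpace.norm_sq_eq]
    refine le_trans ?_ (Finset.sum_mul_sq_le_sq_mul_sq _ _ _)
    refine pow_le_pow_left₀ (norm_nonneg _) ?_ 2
    rw [Matrix.sum_apply]
    refine (norm_sum_le _ _).trans (le_of_eq ?_)
    simp
  calc _ ≤ ∑ i, ∑ j, ‖c‖ ^ 2 * ∑ k, ‖L k i j‖ ^ 2 :=
        Finset.sum_le_sum fun i _ => Finset.sum_le_sum fun j _ => h i j
    _ = _ := by
        simp only [hsNormSq, ← Finset.mul_sum]
        congr 1
        rw [Finset.sum_comm]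
        rw [Finset.sum_comm (s := (Finset.univ : Finset (Fin m)))]
        rw [Finset.sum_comm]
        exact Finset.sum_congr rfl fun i _ => Finset.sum_comm

end HilbertSchmidt

section Chart

open Matrix Filter Topology

variable {n : ℕ} {G : Type*} [TopologicalSpace G]
  [ChartedSpace (EuclideanSpace ℝ (Fin n)) G] [Group G]

namespace UnitaryIrrep

variable (V : UnitaryIrrep n G)

/-- A matrix coefficient in the chart at the identity. -/
def chartCoeff (i j : Fin V.dim) (u : EuclideanSpace ℝ (Fin n)) : ℂ :=
  V.mat ((extChartAt (𝓡 n) (1 : G)).symm u) i j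

/-- The differential `dπ` of the representation, with the Lie algebra written as `ℝ^n` and the
derivative taken in the chart at the identity. -/
def dRep : EuclideanSpace ℝ (Fin n) →ₗ[ℝ] Matrix (Fin V.dim) (Fin V.dim) ℂ where
  toFun X := Matrix.of fun i j => fderiv ℝ (V.chartCoeff i j) (extChartAt (𝓡 n) (1 : G) 1) X
  map_add' X Y := by ext i j; simp only [Matrix.of_apply, Matrix.add_apply, map_add]
  map_smul' c X := by
    ext i j; simp only [Matrix.of_apply, Matrix.smul_apply, map_smul, RingHom.id_apply]

theorem dRep_apply (X : EuclideanSpace ℝ (Fin n)) (i j : Fin V.dim) :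
    V.dRep X i j = fderiv ℝ (V.chartCoeff i j) (extChartAt (𝓡 n) (1 : G) 1) X := rfl

theorem lieMat_eq_dRep (X : GroupLieAlgebra (𝓡 n) G) : V.lieMat X = V.dRep X := by
  ext i j
  have h : MDifferentiableAt (𝓡 n) 𝓘(ℝ, ℂ) (fun g : G => V.mat g i j) 1 :=
    (V.smooth i j).mdifferentiableAt (by simp)
  change mfderiv (𝓡 n) 𝓘(ℝ, ℂ) (fun g : G => V.mat g i j) 1 X = _
  rw [h.mfderiv, ModelWithCorners.Boundaryless.range_eq_univ, fderivWithin_univ]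
  rfl

theorem dRep_eq_sum (X : EuclideanSpace ℝ (Fin n)) :
    V.dRep X = ∑ k, ((X k : ℝ) : ℂ) • V.dRep (EuclideanSpace.basisFun (Fin n) ℝ k) := by
  conv_lhs => rw [← (EuclideanSpace.basisFun (Fin n) ℝ).sum_repr X]
  rw [map_sum]
  refine Finset.sum_congr rfl fun k _ => ?_
  rw [map_smul]
  ext i j
  simp

/-- The sum `∑ ‖dπ(X_k)‖²` of squared Hilbert–Schmidt norms over the standard basis of `𝔤`, that is,
the trace of `-∑ dπ(X_k)²`. This plays the role of `dim · c₂` for the metric on `𝔤` in which the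
standard basis, rather than a basis adapted to the Killing form, is orthonormal. -/
def energy : ℝ := ∑ k, hsNormSq (V.dRep (EuclideanSpace.basisFun (Fin n) ℝ k))

theorem energy_nonneg : 0 ≤ V.energy := Finset.sum_nonneg fun _ _ => hsNormSq_nonneg _

theorem hsNormSq_dRep_le (X : EuclideanSpace ℝ (Fin n)) :
    hsNormSq (V.dRep X) ≤ ‖X‖ ^ 2 * V.energy := by
  rw [dRep_eq_sum]
  exact hsNormSq_sum_smul_le _ _

theorem differentiableAt_chartCoeff [IsManifold (𝓡 n) ∞ G] (i j : Fin V.dim)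
    {u : EuclideanSpace ℝ (Fin n)} (hu : u ∈ (extChartAt (𝓡 n) (1 : G)).target) :
    DifferentiableAt ℝ (V.chartCoeff i j) u := by
  have h1 : ContMDiffAt 𝓘(ℝ, EuclideanSpace ℝ (Fin n)) (𝓡 n) ∞
      (extChartAt (𝓡 n) (1 : G)).symm u :=
    (contMDiffOn_extChartAt_symm (1 : G)).contMDiffAt
      ((isOpen_extChartAt_target (1 : G)).mem_nhds hu)
  exact (((V.smooth i j).contMDiffAt.comp u h1).contDiffAt).differentiableAt (by simp)

end UnitaryIrrep

variable (n G) in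
/-- The map `(x, y) ↦ x⁻¹ y` in the chart at the identity. -/
def chartDiv (p : EuclideanSpace ℝ (Fin n) × EuclideanSpace ℝ (Fin n)) :
    EuclideanSpace ℝ (Fin n) :=
  extChartAt (𝓡 n) (1 : G)
    (((extChartAt (𝓡 n) (1 : G)).symm p.1)⁻¹ * (extChartAt (𝓡 n) (1 : G)).symm p.2)

theorem contDiffAt_chartDiv [LieGroup (𝓡 n) ∞ G] :
    ContDiffAt ℝ ∞ (chartDiv n G) (extChartAt (𝓡 n) (1 : G) 1, extChartAt (𝓡 n) (1 : G) 1) := by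
  set φ := extChartAt (𝓡 n) (1 : G) with hφ
  have hs : ContMDiffAt 𝓘(ℝ, EuclideanSpace ℝ (Fin n)) (𝓡 n) ∞ φ.symm (φ 1) :=
    (contMDiffOn_extChartAt_symm (1 : G)).contMDiffAt
      ((isOpen_extChartAt_target (1 : G)).mem_nhds (mem_extChartAt_target (1 : G)))
  have h1 : ContMDiffAt 𝓘(ℝ, EuclideanSpace ℝ (Fin n) × EuclideanSpace ℝ (Fin n)) (𝓡 n) ∞
      (fun p : EuclideanSpace ℝ (Fin n) × EuclideanSpace ℝ (Fin n) => φ.symm p.1) (φ 1, φ 1) :=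
    ContMDiffAt.comp (φ 1, φ 1) (g := φ.symm) (f := Prod.fst) hs contDiff_fst.contMDiff.contMDiffAt
  have h2 : ContMDiffAt 𝓘(ℝ, EuclideanSpace ℝ (Fin n) × EuclideanSpace ℝ (Fin n)) (𝓡 n) ∞
      (fun p : EuclideanSpace ℝ (Fin n) × EuclideanSpace ℝ (Fin n) => φ.symm p.2) (φ 1, φ 1) :=
    ContMDiffAt.comp (φ 1, φ 1) (g := φ.symm) (f := Prod.snd) hs contDiff_snd.contMDiff.contMDiffAt
  have h3 := h1.inv.mul h2
  have h4 : ContMDiffAt (𝓡 n) 𝓘(ℝ, EuclideanSpace ℝ (Fin n)) ∞ φ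
      ((φ.symm (φ 1))⁻¹ * φ.symm (φ 1)) := by
    rw [inv_mul_cancel]
    exact contMDiffAt_extChartAt
  exact (ContMDiffAt.comp (φ 1, φ 1) h4 h3).contDiffAt

/-- The derivative of a representation in the chart is the representation times its differential
applied to the left logarithmic derivative of the chart. -/
theorem UnitaryIrrep.fderiv_chartCoeff [LieGroup (𝓡 n) ∞ G] (V : UnitaryIrrep n G)
    {u : EuclideanSpace ℝ (Fin n)} (hu : u ∈ (extChartAt (𝓡 n) (1 : G)).target)
    (hd : DifferentiableAt ℝ (chartDiv n G) (u, u)) (i j : Fin V.dim)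
    (w : EuclideanSpace ℝ (Fin n)) :
    fderiv ℝ (V.chartCoeff i j) u w =
      (V.mat ((extChartAt (𝓡 n) (1 : G)).symm u) *
        V.dRep (fderiv ℝ (chartDiv n G) (u, u) (0, w))) i j := by
  have : IsManifold (𝓡 n) ∞ G := inferInstance
  have : IsTopologicalGroup G := topologicalGroup_of_lieGroup (𝓡 n) ∞
  have h0 : chartDiv n G (u, u) = extChartAt (𝓡 n) (1 : G) 1 := by
    simp only [chartDiv, inv_mul_cancel]
  have hev : V.chartCoeff i j =ᶠ[𝓝 u] fun v => ∑ k,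
      V.mat ((extChartAt (𝓡 n) (1 : G)).symm u) i k * V.chartCoeff k j (chartDiv n G (u, v)) := by
    have hc : ContinuousAt (fun v => ((extChartAt (𝓡 n) (1 : G)).symm u)⁻¹ *
        (extChartAt (𝓡 n) (1 : G)).symm v) u :=
      continuousAt_const.mul (continuousAt_extChartAt_symm'' hu)
    have hm : (extChartAt (𝓡 n) (1 : G)).source ∈ 𝓝 (((extChartAt (𝓡 n) (1 : G)).symm u)⁻¹ *
        (extChartAt (𝓡 n) (1 : G)).symm u) := by
      rw [inv_mul_cancel]
      exact extChartAt_source_mem_nhds (1 : G)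
    filter_upwards [hc.preimage_mem_nhds hm] with v hv
    have h5 : (extChartAt (𝓡 n) (1 : G)).symm v = (extChartAt (𝓡 n) (1 : G)).symm u *
        (extChartAt (𝓡 n) (1 : G)).symm (chartDiv n G (u, v)) := by
      rw [chartDiv, (extChartAt (𝓡 n) (1 : G)).left_inv hv, mul_inv_cancel_left]
    rw [UnitaryIrrep.chartCoeff, h5, V.mat_mul, Matrix.mul_apply]
    rfl
  have hdd : HasFDerivAt (fun v => chartDiv n G (u, v))
      ((fderiv ℝ (chartDiv n G) (u, u)).comp (ContinuousLinearMap.inr ℝ _ _)) u :=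
    HasFDerivAt.comp u (hd.hasFDerivAt) (hasFDerivAt_prodMk_right u u)
  have hF : ∀ k, HasFDerivAt (fun v => V.chartCoeff k j (chartDiv n G (u, v)))
      ((fderiv ℝ (V.chartCoeff k j) (extChartAt (𝓡 n) (1 : G) 1)).comp
        ((fderiv ℝ (chartDiv n G) (u, u)).comp (ContinuousLinearMap.inr ℝ _ _))) u := by
    intro k
    have h6 := (V.differentiableAt_chartCoeff k j
      (mem_extChartAt_target (I := 𝓡 n) (1 : G))).hasFDerivAt
    rw [← h0] at h6 ⊢
    exact HasFDerivAt.comp u h6 hdd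
  have hsum := HasFDerivAt.fun_sum (u := Finset.univ) fun k _ => (hF k).const_mul
    (V.mat ((extChartAt (𝓡 n) (1 : G)).symm u) i k)
  rw [hev.fderiv_eq, hsum.fderiv, Matrix.mul_apply]
  simp [UnitaryIrrep.dRep_apply]

/-- Near the identity, every representation is Lipschitz in the chart with constant `C √energy`,
where `C` and the size of the neighbourhood do not depend on the representation. -/
theorem exists_lipschitz_chart [LieGroup (𝓡 n) ∞ G] :
    ∃ C > 0, ∃ r > 0, ∀ V : UnitaryIrrep n G, ∀ u ∈ Metric.ball (extChartAt (𝓡 n) (1 : G) 1) r,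
        ∀ v ∈ Metric.ball (extChartAt (𝓡 n) (1 : G) 1) r,
        hsNormSq (V.mat ((extChartAt (𝓡 n) (1 : G)).symm u) -
          V.mat ((extChartAt (𝓡 n) (1 : G)).symm v)) ≤ (C * ‖u - v‖) ^ 2 * V.energy := by
  have : IsManifold (𝓡 n) ∞ G := inferInstance
  set φ := extChartAt (𝓡 n) (1 : G) with hφ
  have hΦ : ContDiffAt ℝ 1 (chartDiv n G) (φ 1, φ 1) := contDiffAt_chartDiv.of_le (by simp)
  have h1 : ∀ᶠ p in 𝓝 (φ 1, φ 1), DifferentiableAt ℝ (chartDiv n G) p :=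
    (hΦ.eventually (by simp)).mono fun p hp => hp.differentiableAt (by simp)
  have h2 : ∀ᶠ p in 𝓝 (φ 1, φ 1),
      ‖fderiv ℝ (chartDiv n G) p‖ < ‖fderiv ℝ (chartDiv n G) (φ 1, φ 1)‖ + 1 :=
    ((hΦ.fderiv_right (m := 0) (by simp)).continuousAt.norm).eventually_lt_const (by simp)
  set C := ‖fderiv ℝ (chartDiv n G) (φ 1, φ 1)‖ + 1 with hC
  have hdiag : Tendsto (fun u => (u, u)) (𝓝 (φ 1)) (𝓝 (φ 1, φ 1)) :=
    (continuous_id.prodMk continuous_id).tendsto (φ 1)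
  obtain ⟨r, hr, hball⟩ := Metric.eventually_nhds_iff_ball.1 ((hdiag.eventually (h1.and h2)).and
    ((isOpen_extChartAt_target (1 : G)).mem_nhds (mem_extChartAt_target (I := 𝓡 n) (1 : G))))
  refine ⟨C, by positivity, r, hr, fun V u hu v hv => ?_⟩
  set D := V.mat (φ.symm u) - V.mat (φ.symm v) with hD
  -- Pairing with the fixed matrix `D` reduces the estimate to a scalar mean value inequality.
  let f : EuclideanSpace ℝ (Fin n) → ℂ := fun x => ∑ i, ∑ j, star (D i j) * V.chartCoeff i j x
  have hfd : ∀ x ∈ Metric.ball (φ 1) r, HasFDerivAt f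
      (∑ i, ∑ j, star (D i j) • fderiv ℝ (V.chartCoeff i j) x) x := fun x hx =>
    HasFDerivAt.fun_sum fun i _ => HasFDerivAt.fun_sum fun j _ =>
      (V.differentiableAt_chartCoeff i j (hball x hx).2).hasFDerivAt.const_mul _
  have hbound : ∀ x ∈ Metric.ball (φ 1) r, ‖fderiv ℝ f x‖ ≤
      √(hsNormSq D) * (C * √V.energy) := by
    intro x hx
    rw [(hfd x hx).fderiv]
    refine ContinuousLinearMap.opNorm_le_bound _ (by positivity) fun w => ?_
    obtain ⟨⟨hx1, hx2⟩, hx3⟩ := hball x hx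
    simp only [_root_.sum_apply, _root_.smul_apply, smul_eq_mul,
      V.fderiv_chartCoeff hx3 hx1]
    refine (norm_sum_star_mul_le _ _).trans ?_
    rw [mul_assoc]
    refine mul_le_mul_of_nonneg_left ?_ (Real.sqrt_nonneg _)
    rw [hsNormSq_mul_of_conjTranspose_mul_self (V.conjTranspose_mul_mat _)]
    refine Real.sqrt_le_iff.2 ⟨by positivity, (V.hsNormSq_dRep_le _).trans ?_⟩
    have h7 : ‖fderiv ℝ (chartDiv n G) (x, x) (0, w)‖ ≤ C * ‖w‖ := by
      refine (ContinuousLinearMap.le_opNorm _ _).trans ?_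
      refine mul_le_mul hx2.le ?_ (norm_nonneg _) (by positivity)
      simp [Prod.norm_def]
    calc _ ≤ (C * ‖w‖) ^ 2 * V.energy :=
          mul_le_mul_of_nonneg_right (pow_le_pow_left₀ (norm_nonneg _) h7 2) V.energy_nonneg
      _ = (C * ‖w‖) ^ 2 * √V.energy ^ 2 := by rw [Real.sq_sqrt V.energy_nonneg]
      _ = (C * √V.energy * ‖w‖) ^ 2 := by ring
  have hmv := (convex_ball (φ 1) r).norm_image_sub_le_of_norm_fderiv_le
    (fun x hx => (hfd x hx).differentiableAt) hbound hv hu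
  have hfD : f u - f v = (hsNormSq D : ℂ) := by
    simp only [f, hsNormSq, ← Finset.sum_sub_distrib, ← mul_sub]
    push_cast
    refine Finset.sum_congr rfl fun i _ => Finset.sum_congr rfl fun j _ => ?_
    rw [← Complex.conj_mul', ← RCLike.star_def]
    rfl
  rw [hfD, Complex.norm_real, Real.norm_of_nonneg (hsNormSq_nonneg _)] at hmv
  have hs := Real.sq_sqrt (hsNormSq_nonneg D)
  have he := Real.sq_sqrt V.energy_nonneg
  have h8 : √(hsNormSq D) ≤ C * √V.energy * ‖u - v‖ := by
    rcases (Real.sqrt_nonneg (hsNormSq D)).eq_or_lt with h | h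
    · rw [← h]; positivity
    · refine le_of_mul_le_mul_left ?_ h
      calc _ = hsNormSq D := by rw [← sq, hs]
        _ ≤ _ := hmv
        _ = _ := by ring
  calc hsNormSq D = √(hsNormSq D) ^ 2 := hs.symm
    _ ≤ (C * √V.energy * ‖u - v‖) ^ 2 := pow_le_pow_left₀ (Real.sqrt_nonneg _) h8 2
    _ = (C * ‖u - v‖) ^ 2 * √V.energy ^ 2 := by ring
    _ = _ := by rw [he]

end Chart

/-! ### The differential of a representation is a Lie algebra homomorphism -/

section Bracket

open Matrix Filter Topology VectorField Set

variable {n : ℕ} {G : Type*} [TopologicalSpace G]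
  [ChartedSpace (EuclideanSpace ℝ (Fin n)) G] [Group G] [LieGroup (𝓡 n) ∞ G]

theorem two_le_infty : (2 : WithTop ℕ∞) ≤ ∞ :=
  WithTop.coe_le_coe.2 (le_top : (2 : ℕ∞) ≤ ⊤)

/-- The left-invariant vector field with value `X` at the identity, in the chart at the identity. -/
def chartField (X : GroupLieAlgebra (𝓡 n) G) :
    EuclideanSpace ℝ (Fin n) → EuclideanSpace ℝ (Fin n) :=
  mpullbackWithin 𝓘(ℝ, EuclideanSpace ℝ (Fin n)) (𝓡 n) (extChartAt (𝓡 n) (1 : G)).symm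
    (mulInvariantVectorField X) (range (𝓡 n))

namespace UnitaryIrrep

variable (V : UnitaryIrrep n G)

/-- Along the left-invariant vector field of `X`, the derivative of `π` is `π · dπ(X)`. -/
theorem mfderiv_mat_mulInvariantVectorField (X : GroupLieAlgebra (𝓡 n) G) (x : G)
    (i j : Fin V.dim) :
    mfderiv (𝓡 n) 𝓘(ℝ, ℂ) (fun g : G => V.mat g i j) x (mulInvariantVectorField X x)
      = (V.mat x * V.dRep X) i j := by
  have hs : ∀ i j (x : G), MDifferentiableAt (𝓡 n) 𝓘(ℝ, ℂ) (fun g : G => V.mat g i j) x :=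
    fun i j x => (V.smooth i j).mdifferentiableAt (by simp)
  have hl : MDifferentiableAt (𝓡 n) (𝓡 n) (fun y : G => x * y) 1 :=
    (contMDiff_mul_left (I := 𝓡 n) (n := ∞)).mdifferentiableAt (by simp)
  have h1 : mfderiv (𝓡 n) 𝓘(ℝ, ℂ) (fun g : G => V.mat (x * g) i j) 1 X
      = mfderiv (𝓡 n) 𝓘(ℝ, ℂ) (fun g : G => V.mat g i j) (x * 1)
          (mfderiv (𝓡 n) (𝓡 n) (fun y : G => x * y) 1 X) := by
    have := mfderiv_comp (I := 𝓡 n) (I' := 𝓡 n) (I'' := 𝓘(ℝ, ℂ)) (1 : G) (hs i j (x * 1)) hl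
    exact congrArg (fun L => L X) this
  have hd : MDifferentiableAt (𝓡 n) 𝓘(ℝ, ℂ) (fun g : G => V.mat (x * g) i j) 1 :=
    MDifferentiableAt.comp (1 : G) (hs i j (x * 1)) hl
  have h2 : mfderiv (𝓡 n) 𝓘(ℝ, ℂ) (fun g : G => V.mat (x * g) i j) 1 X
      = (V.mat x * V.dRep X) i j := by
    rw [hd.mfderiv, ModelWithCorners.Boundaryless.range_eq_univ, fderivWithin_univ]
    have e : writtenInExtChartAt (𝓡 n) 𝓘(ℝ, ℂ) (1 : G) (fun g : G => V.mat (x * g) i j)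
        = fun u => ∑ k, V.mat x i k * V.chartCoeff k j u := by
      funext u
      change V.mat (x * _) i j = _
      rw [V.mat_mul, Matrix.mul_apply]
      rfl
    have h3 := HasFDerivAt.fun_sum (u := Finset.univ) fun k _ =>
      ((V.differentiableAt_chartCoeff k j
        (mem_extChartAt_target (I := 𝓡 n) (1 : G))).hasFDerivAt).const_mul (V.mat x i k)
    have h4 : fderiv ℝ (fun u => ∑ k, V.mat x i k * V.chartCoeff k j u)
        (extChartAt (𝓡 n) (1 : G) 1) X = ∑ k, V.mat x i k * V.dRep X k j := by
      rw [h3.fderiv]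
      exact _root_.sum_apply _ _ _
    rw [e, Matrix.mul_apply]
    exact h4
  rw [← h2, h1, mul_one]
  rfl

theorem fderiv_chartCoeff_chartField (X : GroupLieAlgebra (𝓡 n) G) (i j : Fin V.dim)
    {u : EuclideanSpace ℝ (Fin n)} (hu : u ∈ (extChartAt (𝓡 n) (1 : G)).target) :
    fderiv ℝ (V.chartCoeff i j) u (chartField X u)
      = ∑ k, V.chartCoeff i k u * V.dRep X k j := by
  have : IsManifold (𝓡 n) ∞ G := inferInstance
  have : IsManifold (𝓡 n) 1 G := IsManifold.of_le (n := ∞) (by simp)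
  have hinv := isInvertible_mfderivWithin_extChartAt_symm (I := 𝓡 n) (x := (1 : G)) hu
  have h1 : mfderivWithin 𝓘(ℝ, EuclideanSpace ℝ (Fin n)) (𝓡 n)
      (extChartAt (𝓡 n) (1 : G)).symm (range (𝓡 n)) u (chartField X u)
      = mulInvariantVectorField X ((extChartAt (𝓡 n) (1 : G)).symm u) := by
    rw [chartField, mpullbackWithin_apply]
    exact hinv.self_apply_inverse _
  have h2 : MDifferentiableAt (𝓡 n) 𝓘(ℝ, ℂ) (fun g : G => V.mat g i j)
      ((extChartAt (𝓡 n) (1 : G)).symm u) := (V.smooth i j).mdifferentiableAt (by simp)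
  have h3 : MDifferentiableAt 𝓘(ℝ, EuclideanSpace ℝ (Fin n)) (𝓡 n)
      (extChartAt (𝓡 n) (1 : G)).symm u :=
    ((contMDiffOn_extChartAt_symm (n := 1) (1 : G)).contMDiffAt
      ((isOpen_extChartAt_target (1 : G)).mem_nhds hu)).mdifferentiableAt (by simp)
  have h4 := mfderiv_comp u h2 h3
  rw [ModelWithCorners.Boundaryless.range_eq_univ, mfderivWithin_univ] at h1
  have h5 : fderiv ℝ (V.chartCoeff i j) u
      = mfderiv 𝓘(ℝ, EuclideanSpace ℝ (Fin n)) 𝓘(ℝ, ℂ)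
        ((fun g : G => V.mat g i j) ∘ (extChartAt (𝓡 n) (1 : G)).symm) u := by
    rw [mfderiv_eq_fderiv]; rfl
  rw [h5, h4]
  change mfderiv (𝓡 n) 𝓘(ℝ, ℂ) (fun g : G => V.mat g i j) ((extChartAt (𝓡 n) (1 : G)).symm u)
    (mfderiv 𝓘(ℝ, EuclideanSpace ℝ (Fin n)) (𝓡 n)
      (extChartAt (𝓡 n) (1 : G)).symm u (chartField X u)) = _
  rw [h1, V.mfderiv_mat_mulInvariantVectorField, Matrix.mul_apply]
  rfl

/-- In the chart, the function `dF(W) = F · dπ(W)` can be differentiated along a second invariant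
vector field; antisymmetrizing removes the second derivative of `F` and leaves the bracket. -/
theorem dRep_bracket (X Y : GroupLieAlgebra (𝓡 n) G) :
    V.dRep (⁅X, Y⁆ : GroupLieAlgebra (𝓡 n) G)
      = V.dRep X * V.dRep Y - V.dRep Y * V.dRep X := by
  have : IsManifold (𝓡 n) ∞ G := inferInstance
  have : IsManifold (𝓡 n) 2 G := IsManifold.of_le (n := ∞) two_le_infty
  have : IsManifold (𝓡 n) 1 G := IsManifold.of_le (n := ∞) (by simp)
  set e := extChartAt (𝓡 n) (1 : G) 1 with he
  have het : e ∈ (extChartAt (𝓡 n) (1 : G)).target := mem_extChartAt_target (1 : G)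
  have hsymm : (extChartAt (𝓡 n) (1 : G)).symm e = 1 := extChartAt_to_inv (1 : G)
  have hdiff : ∀ Z : GroupLieAlgebra (𝓡 n) G, DifferentiableAt ℝ (chartField Z) e := by
    intro Z
    have := (mdifferentiableAt_mulInvariantVectorField Z
      (g := (1 : G))).mdifferentiableWithinAt (s := univ)
        |>.differentiableWithinAt_mpullbackWithin_vectorField
    rw [preimage_univ, univ_inter] at this
    exact DifferentiableWithinAt.differentiableAt this
      (by rw [ModelWithCorners.Boundaryless.range_eq_univ]; exact univ_mem)
  have hone : ∀ (M : Matrix (Fin V.dim) (Fin V.dim) ℂ) i j,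
      ∑ k, V.chartCoeff i k e * M k j = M i j := by
    intro M i j
    have : (V.mat 1 * M) i j = M i j := by rw [V.mat_one, Matrix.one_mul]
    rw [← this, Matrix.mul_apply]
    simp only [UnitaryIrrep.chartCoeff, hsymm]
  have hval : ∀ (Z : GroupLieAlgebra (𝓡 n) G) i j,
      fderiv ℝ (V.chartCoeff i j) e (chartField Z e) = V.dRep Z i j := by
    intro Z i j
    rw [V.fderiv_chartCoeff_chartField Z i j het, hone]
  have hC2 : ∀ i j, ContDiffAt ℝ ∞ (V.chartCoeff i j) e := by
    intro i j
    have h1 : ContMDiffAt 𝓘(ℝ, EuclideanSpace ℝ (Fin n)) (𝓡 n) ∞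
        (extChartAt (𝓡 n) (1 : G)).symm e :=
      (contMDiffOn_extChartAt_symm (1 : G)).contMDiffAt
        ((isOpen_extChartAt_target (1 : G)).mem_nhds het)
    exact ((V.smooth i j).contMDiffAt.comp e h1).contDiffAt
  -- Differentiating `dF(W) = F · dπ(W)` along the other vector field.
  have hder : ∀ (Z W : GroupLieAlgebra (𝓡 n) G) i j,
      fderiv ℝ (fderiv ℝ (V.chartCoeff i j)) e (chartField Z e) (chartField W e)
        + fderiv ℝ (V.chartCoeff i j) e (fderiv ℝ (chartField W) e (chartField Z e))
        = (V.dRep Z * V.dRep W) i j := by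
    intro Z W i j
    have h1 : HasFDerivAt (fderiv ℝ (V.chartCoeff i j))
        (fderiv ℝ (fderiv ℝ (V.chartCoeff i j)) e) e :=
      (((hC2 i j).fderiv_right (m := 1) two_le_infty).differentiableAt (by simp)).hasFDerivAt
    have h2 := h1.clm_apply (hdiff W).hasFDerivAt
    have hev : (fun u => fderiv ℝ (V.chartCoeff i j) u (chartField W u))
        =ᶠ[𝓝 e] fun u => ∑ k, V.dRep W k j * V.chartCoeff i k u := by
      filter_upwards [(isOpen_extChartAt_target (I := 𝓡 n) (1 : G)).mem_nhds het] with u hu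
      rw [V.fderiv_chartCoeff_chartField W i j hu]
      exact Finset.sum_congr rfl fun k _ => mul_comm _ _
    have h3 := HasFDerivAt.fun_sum (u := Finset.univ) fun k _ =>
      (V.differentiableAt_chartCoeff i k het).hasFDerivAt.const_mul (V.dRep W k j)
    have h4 := congrArg (fun L => L (chartField Z e)) (h2.unique (h3.congr_of_eventuallyEq hev))
    simp only [_root_.sum_apply, _root_.smul_apply, hval, smul_eq_mul] at h4
    rw [Matrix.mul_apply]
    simp only [mul_comm (V.dRep Z i _)]
    rw [← h4, add_comm]
    rfl
  have hsym : ∀ i j, fderiv ℝ (fderiv ℝ (V.chartCoeff i j)) e (chartField X e) (chartField Y e)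
      = fderiv ℝ (fderiv ℝ (V.chartCoeff i j)) e (chartField Y e) (chartField X e) := fun i j =>
    ((hC2 i j).isSymmSndFDerivAt (by simpa using two_le_infty)).eq _ _
  have hbr : ∀ i j, V.dRep (⁅X, Y⁆ : GroupLieAlgebra (𝓡 n) G) i j
      = fderiv ℝ (V.chartCoeff i j) e (lieBracket ℝ (chartField X) (chartField Y) e) := by
    intro i j
    have hinv := isInvertible_mfderiv_extChartAt (I := 𝓡 n) (mem_extChartAt_source (I := 𝓡 n) (1 : G))
    have h1 : mfderiv (𝓡 n) 𝓘(ℝ, EuclideanSpace ℝ (Fin n)) (extChartAt (𝓡 n) (1 : G)) 1 ⁅X, Y⁆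
        = lieBracket ℝ (chartField X) (chartField Y) e := by
      have h0 : lieBracket ℝ (chartField X) (chartField Y) e =
          lieBracketWithin ℝ (chartField X) (chartField Y)
            ((extChartAt (𝓡 n) (1 : G)).symm ⁻¹' univ ∩ range (𝓡 n)) e := by
        rw [ModelWithCorners.Boundaryless.range_eq_univ, preimage_univ, univ_inter,
          lieBracketWithin_univ]
      rw [h0]
      exact hinv.self_apply_inverse _
    have h2 : MDifferentiableAt (𝓡 n) 𝓘(ℝ, EuclideanSpace ℝ (Fin n))
        (extChartAt (𝓡 n) (1 : G)) 1 := mdifferentiableAt_extChartAt (mem_chart_source _ _)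
    have h3 : MDifferentiableAt 𝓘(ℝ, EuclideanSpace ℝ (Fin n)) 𝓘(ℝ, ℂ) (V.chartCoeff i j) e :=
      (V.differentiableAt_chartCoeff i j het).mdifferentiableAt
    have h4 : mfderiv (𝓡 n) 𝓘(ℝ, ℂ) (V.chartCoeff i j ∘ extChartAt (𝓡 n) (1 : G)) 1 = _ :=
      mfderiv_comp (1 : G) h3 h2
    have h5 : (V.chartCoeff i j ∘ extChartAt (𝓡 n) (1 : G)) =ᶠ[𝓝 1] fun g => V.mat g i j := by
      filter_upwards [extChartAt_source_mem_nhds (I := 𝓡 n) (1 : G)] with g hg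
      rw [Function.comp_apply, UnitaryIrrep.chartCoeff, (extChartAt (𝓡 n) (1 : G)).left_inv hg]
    rw [← V.lieMat_eq_dRep]
    change mfderiv (𝓡 n) 𝓘(ℝ, ℂ) (fun g : G => V.mat g i j) 1 ⁅X, Y⁆ = _
    rw [← h1, ← h5.mfderiv_eq, h4, mfderiv_eq_fderiv]
    rfl
  ext i j
  rw [hbr, lieBracket, map_sub, Matrix.sub_apply, ← hder X Y i j, ← hder Y X i j, hsym]
  ring

end UnitaryIrrep
end Bracket

/-! ### Negativity of the Killing form and positivity of the Casimir -/

section Skew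

/-- A skew operator on a Euclidean space has a square of nonpositive trace, which vanishes only for
the zero operator. -/
theorem trace_comp_self_of_skew {L : Type*} [AddCommGroup L] [Module ℝ L] [FiniteDimensional ℝ L]
    (b : L →ₗ[ℝ] L →ₗ[ℝ] ℝ) (hsymm : ∀ x y, b x y = b y x) (hpos : ∀ x, x ≠ 0 → 0 < b x x)
    (T : L →ₗ[ℝ] L) (hT : ∀ x y, b (T x) y = -b x (T y)) (hne : T ≠ 0) :
    LinearMap.trace ℝ L (T ∘ₗ T) < 0 := by
  have hnn : ∀ x, 0 ≤ b x x := fun x => by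
    by_cases h : x = 0
    · simp [h]
    · exact (hpos x h).le
  let core : InnerProductSpace.Core ℝ L :=
    { inner := fun x y => b x y
      conj_inner_symm := fun x y => hsymm y x
      re_inner_nonneg := fun x => hnn x
      add_left := fun x y z => by simp
      smul_left := fun x y r => by simp
      definite := fun x hx => by
        by_contra h
        exact (hpos x h).ne' hx }
  let : NormedAddCommGroup L := core.toNormedAddCommGroup
  let : InnerProductSpace ℝ L := InnerProductSpace.ofCore core.toCore
  have hin : ∀ x y : L, inner ℝ x y = b x y := fun _ _ => rfl
  let e := stdOrthonormalBasis ℝ L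
  have h1 : LinearMap.trace ℝ L (T ∘ₗ T) = -∑ i, b (T (e i)) (T (e i)) := by
    rw [LinearMap.trace_eq_sum_inner _ e, ← Finset.sum_neg_distrib]
    refine Finset.sum_congr rfl fun i _ => ?_
    rw [hin, LinearMap.comp_apply, hT, neg_neg]
  rw [h1, neg_lt_zero]
  refine lt_of_le_of_ne (Finset.sum_nonneg fun i _ => hnn _) fun h0 => hne ?_
  have h2 := (Finset.sum_eq_zero_iff_of_nonneg fun i _ => hnn (T (e i))).1 h0.symm
  refine e.toBasis.ext fun i => ?_
  by_contra h
  exact (hpos _ (by simpa using h)).ne' (h2 i (Finset.mem_univ i))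

/-- A positive definite quadratic form on `ℝ^n` dominates a multiple of the Euclidean one. -/
theorem exists_pos_mul_sum_sq_le {n : ℕ} {P : Matrix (Fin n) (Fin n) ℝ} (hP : P.PosDef) :
    ∃ c > 0, ∀ x : Fin n → ℝ, c * ∑ i, x i ^ 2 ≤ ∑ i, ∑ j, P i j * (x i * x j) := by
  let f : EuclideanSpace ℝ (Fin n) → ℝ := fun x => ∑ i, ∑ j, P i j * (x i * x j)
  have hf : Continuous f := by fun_prop
  have hpos : ∀ x : EuclideanSpace ℝ (Fin n), x ≠ 0 → 0 < f x := by
    intro x hx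
    have h := hP.dotProduct_mulVec_pos (x := x.ofLp) (fun h => hx (by ext i; exact congrFun h i))
    have e : f x = star x.ofLp ⬝ᵥ P.mulVec x.ofLp := by
      simp only [f, dotProduct, Matrix.mulVec, Finset.mul_sum, Pi.star_apply, star_trivial]
      exact Finset.sum_congr rfl fun i _ => Finset.sum_congr rfl fun j _ => by ring
    rw [e]; exact h
  obtain ⟨c, hc, hcs⟩ : ∃ c > 0, ∀ x ∈ Metric.sphere (0 : EuclideanSpace ℝ (Fin n)) 1, c ≤ f x := by
    rcases (Metric.sphere (0 : EuclideanSpace ℝ (Fin n)) 1).eq_empty_or_nonempty with h | h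
    · exact ⟨1, one_pos, by simp [h]⟩
    · obtain ⟨x, hx, hmin⟩ := (isCompact_sphere (0 : EuclideanSpace ℝ (Fin n)) 1).exists_isMinOn h
        hf.continuousOn
      refine ⟨f x, hpos x ?_, fun y hy => hmin hy⟩
      rintro rfl
      simp at hx
  refine ⟨c, hc, fun x => ?_⟩
  set y : EuclideanSpace ℝ (Fin n) := WithLp.toLp 2 x with hy
  have hfy : ∑ i, ∑ j, P i j * (x i * x j) = f y := rfl
  have hny : ∑ i, x i ^ 2 = ‖y‖ ^ 2 := by
    rw [EuclideanSpace.norm_sq_eq]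
    simp [hy]
  rw [hfy, hny]
  by_cases h0 : y = 0
  · simp [h0, f]
  have hn : ‖y‖ ≠ 0 := norm_ne_zero_iff.2 h0
  have h1 := hcs (‖y‖⁻¹ • y) (by simp [norm_smul, hn])
  have h2 : f (‖y‖⁻¹ • y) = ‖y‖⁻¹ ^ 2 * f y := by
    simp only [f, Finset.mul_sum, PiLp.smul_apply, smul_eq_mul]
    exact Finset.sum_congr rfl fun i _ => Finset.sum_congr rfl fun j _ => by ring
  rw [h2] at h1
  calc c * ‖y‖ ^ 2 ≤ ‖y‖⁻¹ ^ 2 * f y * ‖y‖ ^ 2 := by gcongr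
    _ = f y := by field_simp

end Skew

section Killing

open Matrix Filter Topology

variable {n : ℕ} {G : Type*} [TopologicalSpace G]
  [ChartedSpace (EuclideanSpace ℝ (Fin n)) G] [Group G] [LieGroup (𝓡 n) ∞ G]

namespace UnitaryIrrep

variable (V : UnitaryIrrep n G)

/-- The differential of a unitary representation is skew-Hermitian. -/
theorem conjTranspose_dRep (X : EuclideanSpace ℝ (Fin n)) : (V.dRep X)ᴴ = -V.dRep X := by
  have : IsManifold (𝓡 n) ∞ G := inferInstance
  have het : extChartAt (𝓡 n) (1 : G) 1 ∈ (extChartAt (𝓡 n) (1 : G)).target :=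
    mem_extChartAt_target (1 : G)
  have hone : ∀ i j, V.chartCoeff i j (extChartAt (𝓡 n) (1 : G) 1) = (1 : Matrix _ _ ℂ) i j := by
    intro i j
    rw [UnitaryIrrep.chartCoeff, extChartAt_to_inv, V.mat_one]
  ext i j
  have hd := fun i j => (V.differentiableAt_chartCoeff i j het).hasFDerivAt
  have h1 := HasFDerivAt.fun_sum (u := Finset.univ) fun k _ => (hd i k).mul (hd j k).star
  have h2 : (fun u => ∑ k, V.chartCoeff i k u * star (V.chartCoeff j k u))
      = fun _ => (1 : Matrix (Fin V.dim) (Fin V.dim) ℂ) i j := by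
    funext u
    rw [← V.mat_mul_conjTranspose ((extChartAt (𝓡 n) (1 : G)).symm u), Matrix.mul_apply]
    rfl
  have h3 := congrArg (fun L => L X) (h1.unique (h2 ▸ hasFDerivAt_const _ _))
  simp only [_root_.sum_apply, _root_.add_apply, _root_.smul_apply, hone, smul_eq_mul] at h3
  rw [Finset.sum_add_distrib] at h3
  simp only [Matrix.one_apply, ite_mul, one_mul, zero_mul, Finset.sum_ite_eq, Finset.mem_univ,
    if_true, apply_ite star, star_one, star_zero] at h3
  rw [Matrix.conjTranspose_apply, Matrix.neg_apply]
  exact eq_neg_of_add_eq_zero_left h3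

/-- The invariant form `(X, Y) ↦ -Re Tr(dπ(X) dπ(Y))` on the Lie algebra. -/
def negTraceForm : GroupLieAlgebra (𝓡 n) G →ₗ[ℝ] GroupLieAlgebra (𝓡 n) G →ₗ[ℝ] ℝ :=
  LinearMap.mk₂ ℝ (fun X Y => -(V.dRep X * V.dRep Y).trace.re)
    (fun X Y Z => by
      have : V.dRep (X + Y) = V.dRep X + V.dRep Y := map_add V.dRep X Y
      rw [this, Matrix.add_mul, Matrix.trace_add, Complex.add_re, neg_add])
    (fun c X Y => by
      have : V.dRep (c • X) = c • V.dRep X := map_smul V.dRep c X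
      rw [this, Matrix.smul_mul, Matrix.trace_smul, Complex.smul_re, smul_neg])
    (fun X Y Z => by
      have : V.dRep (Y + Z) = V.dRep Y + V.dRep Z := map_add V.dRep Y Z
      rw [this, Matrix.mul_add, Matrix.trace_add, Complex.add_re, neg_add])
    (fun c X Y => by
      have : V.dRep (c • Y) = c • V.dRep Y := map_smul V.dRep c Y
      rw [this, Matrix.mul_smul, Matrix.trace_smul, Complex.smul_re, smul_neg])

theorem negTraceForm_apply (X Y : GroupLieAlgebra (𝓡 n) G) :
    V.negTraceForm X Y = -(V.dRep X * V.dRep Y).trace.re := rfl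

theorem negTraceForm_self (X : GroupLieAlgebra (𝓡 n) G) :
    V.negTraceForm X X = hsNormSq (V.dRep X) := by
  have h := hsNormSq_eq_trace (V.dRep X)
  rw [V.conjTranspose_dRep X, Matrix.neg_mul, Matrix.trace_neg] at h
  rw [negTraceForm_apply, ← Complex.neg_re, ← h, Complex.ofReal_re]

theorem negTraceForm_lie (X Y Z : GroupLieAlgebra (𝓡 n) G) :
    V.negTraceForm ⁅X, Y⁆ Z = -V.negTraceForm Y ⁅X, Z⁆ := by
  simp only [negTraceForm_apply, dRep_bracket, neg_neg]
  rw [← Complex.neg_re, ← Matrix.trace_neg]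
  congr 1
  simp only [Matrix.sub_mul, Matrix.mul_sub, neg_sub, Matrix.trace_sub, Matrix.mul_assoc]
  congr 1
  rw [Matrix.trace_mul_comm (V.dRep X), Matrix.mul_assoc]

end UnitaryIrrep

theorem hsNormSq_eq_zero {ι κ : Type*} [Fintype ι] [Fintype κ] {M : Matrix ι κ ℂ} :
    hsNormSq M = 0 ↔ M = 0 := by
  constructor
  · intro h
    ext i j
    have h1 := (Finset.sum_eq_zero_iff_of_nonneg fun i _ =>
      Finset.sum_nonneg fun _ _ => sq_nonneg _).1 h i (Finset.mem_univ i)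
    have h2 := (Finset.sum_eq_zero_iff_of_nonneg fun _ _ => sq_nonneg _).1 h1 j (Finset.mem_univ j)
    simpa using h2
  · rintro rfl
    simp [hsNormSq]

variable [LieAlgebra.IsSimple ℝ (GroupLieAlgebra (𝓡 n) G)]

/-- The kernel of the differential of a representation is an ideal, so the differential of a
representation of a simple group vanishes or is injective. -/
theorem UnitaryIrrep.dRep_injective_of_energy_ne_zero (V : UnitaryIrrep n G) (hV : V.energy ≠ 0)
    (X : GroupLieAlgebra (𝓡 n) G) (hX : V.dRep X = 0) : X = 0 := by
  let I : LieIdeal ℝ (GroupLieAlgebra (𝓡 n) G) :=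
    { carrier := {X | V.dRep X = 0}
      add_mem' := fun {X Y} hX hY => by
        have : V.dRep (X + Y) = V.dRep X + V.dRep Y := map_add V.dRep X Y
        have hX : V.dRep X = 0 := hX
        have hY : V.dRep Y = 0 := hY
        change V.dRep (X + Y) = 0
        rw [this, hX, hY, add_zero]
      zero_mem' := map_zero V.dRep
      smul_mem' := fun c X hX => by
        have : V.dRep (c • X) = c • V.dRep X := map_smul V.dRep c X
        have hX : V.dRep X = 0 := hX
        change V.dRep (c • X) = 0
        rw [this, hX, smul_zero]
      lie_mem := fun {X Y} hY => by
        have hY : V.dRep Y = 0 := hY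
        change V.dRep (⁅X, Y⁆ : GroupLieAlgebra (𝓡 n) G) = 0
        rw [V.dRep_bracket, hY, Matrix.mul_zero, Matrix.zero_mul, sub_zero] }
  rcases LieAlgebra.IsSimple.eq_bot_or_eq_top I with h | h
  · have : X ∈ I := hX
    rw [h] at this
    exact (LieSubmodule.mem_bot X).1 this
  · exfalso
    apply hV
    refine Finset.sum_eq_zero fun k _ => hsNormSq_eq_zero.2 ?_
    have : lieBasis n G k ∈ I := h ▸ LieSubmodule.mem_top _
    exact this

/-- If some representation has a nonzero differential, the Killing form is negative definite. -/
theorem killingForm_self_neg (V : UnitaryIrrep n G) (hV : V.energy ≠ 0)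
    {X : GroupLieAlgebra (𝓡 n) G} (hX : X ≠ 0) :
    killingForm ℝ (GroupLieAlgebra (𝓡 n) G) X X < 0 := by
  have : FiniteDimensional ℝ (GroupLieAlgebra (𝓡 n) G) :=
    inferInstanceAs (FiniteDimensional ℝ (EuclideanSpace ℝ (Fin n)))
  rw [killingForm_apply_apply]
  refine trace_comp_self_of_skew V.negTraceForm (fun X Y => ?_) (fun Y hY => ?_) _
    (fun Y Z => V.negTraceForm_lie X Y Z) (fun h0 => hX ?_)
  · rw [V.negTraceForm_apply, V.negTraceForm_apply, Matrix.trace_mul_comm]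
  · rw [V.negTraceForm_self]
    exact lt_of_le_of_ne (hsNormSq_nonneg _) fun h =>
      hY (V.dRep_injective_of_energy_ne_zero hV Y (hsNormSq_eq_zero.1 h.symm))
  · have h1 : X ∈ LieAlgebra.center ℝ (GroupLieAlgebra (𝓡 n) G) := by
      rw [LieModule.mem_maxTrivSubmodule]
      intro Y
      have : ⁅X, Y⁆ = 0 := congrArg (fun L => L Y) h0
      rw [← lie_skew, this, neg_zero]
    rw [LieAlgebra.center_eq_bot] at h1
    exact (LieSubmodule.mem_bot X).1 h1

theorem posDef_neg_killingGram (V : UnitaryIrrep n G) (hV : V.energy ≠ 0) :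
    (-killingGram n G).PosDef := by
  refine Matrix.PosDef.of_dotProduct_mulVec_pos ?_ fun x hx => ?_
  · ext i j
    simp only [killingGram, Matrix.conjTranspose_apply, Matrix.neg_apply, Matrix.of_apply,
      star_trivial]
    rw [LieModule.traceForm_comm]
  · let X : GroupLieAlgebra (𝓡 n) G := ∑ i, x i • lieBasis n G i
    have hX : X = (WithLp.toLp 2 x : EuclideanSpace ℝ (Fin n)) :=
      (EuclideanSpace.basisFun (Fin n) ℝ).sum_repr (WithLp.toLp 2 x)
    have h0 : X ≠ 0 := by
      intro h
      apply hx
      have h2 : (WithLp.toLp 2 x : EuclideanSpace ℝ (Fin n)) = 0 := hX.symm.trans h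
      exact (WithLp.toLp_eq_zero 2).1 h2
    have h1 := killingForm_self_neg V hV h0
    have h2 : star x ⬝ᵥ (-killingGram n G).mulVec x
        = -killingForm ℝ (GroupLieAlgebra (𝓡 n) G) X X := by
      simp only [X, map_sum, map_smul, LinearMap.sum_apply, LinearMap.smul_apply, smul_eq_mul,
        dotProduct, Matrix.mulVec, Matrix.neg_apply, killingGram, Matrix.of_apply, Pi.star_apply,
        star_trivial, neg_mul, Finset.sum_neg_distrib, mul_neg, Finset.mul_sum]
      congr 1
      rw [Finset.sum_comm]
      exact Finset.sum_congr rfl fun i _ => Finset.sum_congr rfl fun j _ => by ring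
    rw [h2]
    linarith

/-- The Casimir value dominates the energy per dimension, uniformly over all representations. Only
traces enter, so the Casimir need not be known to act as a scalar. -/
theorem exists_pos_mul_energy_le :
    ∃ c > 0, ∀ W : UnitaryIrrep n G, c * (W.energy / W.dim) ≤ W.c₂ := by
  -- If all differentials vanish, both sides are zero; otherwise the Killing form is definite.
  by_cases hall : ∀ V : UnitaryIrrep n G, V.energy = 0
  · refine ⟨1, one_pos, fun W => ?_⟩
    have h0 : ∀ k, W.lieMat (lieBasis n G k) = 0 := fun k => by
      rw [W.lieMat_eq_dRep]
      exact hsNormSq_eq_zero.1 ((Finset.sum_eq_zero_iff_of_nonneg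
        fun _ _ => hsNormSq_nonneg _).1 (hall W) k (Finset.mem_univ k))
    simp [hall W, UnitaryIrrep.c₂, UnitaryIrrep.casimirMat, h0]
  · push Not at hall
    obtain ⟨V, hV⟩ := hall
    obtain ⟨c, hc, hle⟩ := exists_pos_mul_sum_sq_le (posDef_neg_killingGram V hV).inv
    refine ⟨c, hc, fun W => ?_⟩
    set L : Fin n → Matrix (Fin W.dim) (Fin W.dim) ℂ :=
      fun k => W.dRep (EuclideanSpace.basisFun (Fin n) ℝ k) with hL
    have hLl : ∀ k, W.lieMat (lieBasis n G k) = L k := fun k => W.lieMat_eq_dRep _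
    have hinv : (killingGram n G)⁻¹ = -(-killingGram n G)⁻¹ := by
      refine Matrix.inv_eq_right_inv ?_
      rw [Matrix.mul_neg, ← Matrix.neg_mul]
      exact Matrix.mul_nonsing_inv _ (posDef_neg_killingGram V hV).det_pos.ne'.isUnit
    have hLtr : ∀ i j, (L i * L j).trace.re
        = -∑ p, ∑ q, ((L i p q).re * (L j p q).re + (L i p q).im * (L j p q).im) := by
      intro i j
      have h1 : L i = -(L i)ᴴ := by rw [hL, W.conjTranspose_dRep, neg_neg]
      rw [h1, Matrix.neg_mul, Matrix.trace_neg, Complex.neg_re, ← h1, Matrix.trace,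
        Finset.sum_comm, Complex.re_sum]
      congr 1
      refine Finset.sum_congr rfl fun q _ => ?_
      rw [Matrix.diag_apply, Matrix.mul_apply, Complex.re_sum]
      refine Finset.sum_congr rfl fun p _ => ?_
      rw [Matrix.conjTranspose_apply, RCLike.star_def, Complex.mul_re, Complex.conj_re,
        Complex.conj_im]
      ring
    have htr : W.casimirMat.trace.re = ∑ p, ∑ q,
        ((∑ i, ∑ j, (-killingGram n G)⁻¹ i j * ((L i p q).re * (L j p q).re)) +
          (∑ i, ∑ j, (-killingGram n G)⁻¹ i j * ((L i p q).im * (L j p q).im))) := by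
      simp only [UnitaryIrrep.casimirMat, hLl, Matrix.trace_sum, Matrix.trace_smul, smul_eq_mul,
        Complex.re_sum, Complex.re_ofReal_mul, hLtr, hinv, Matrix.neg_apply, neg_mul_neg]
      simp only [← Finset.sum_add_distrib, ← mul_add, Finset.mul_sum]
      simp only [← Fintype.sum_prod_type']
      exact Fintype.sum_equiv ⟨fun x => (x.2.2.1, x.2.2.2, x.1, x.2.1),
        fun x => (x.2.2.1, x.2.2.2, x.1, x.2.1), fun _ => rfl, fun _ => rfl⟩ _ _ fun _ => rfl
    have hc2 : W.c₂ = W.casimirMat.trace.re / W.dim := by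
      rw [UnitaryIrrep.c₂, Complex.div_natCast_re]
    rw [hc2, ← mul_div_assoc]
    refine div_le_div_of_nonneg_right ?_ (Nat.cast_nonneg _)
    rw [htr]
    have hen : W.energy = ∑ p, ∑ q, (∑ i, (L i p q).re ^ 2 + ∑ i, (L i p q).im ^ 2) := by
      simp only [UnitaryIrrep.energy, hsNormSq, Complex.sq_norm, Complex.normSq_apply,
        ← Finset.sum_add_distrib, ← sq]
      rw [Finset.sum_comm]
      exact Finset.sum_congr rfl fun i _ => Finset.sum_comm
    rw [hen, Finset.mul_sum]
    refine Finset.sum_le_sum fun p _ => ?_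
    rw [Finset.mul_sum]
    refine Finset.sum_le_sum fun q _ => ?_
    rw [mul_add]
    exact add_le_add (hle _) (hle _)

end Killing

/-! ### Polynomial growth of the spectrum and convergence of the heat trace -/

section Counting

open Matrix Filter Topology

variable {n : ℕ} {G : Type*} [TopologicalSpace G]
  [ChartedSpace (EuclideanSpace ℝ (Fin n)) G] [Group G]

theorem UnitaryIrrep.hsNormSq_mat_sub_one (V : UnitaryIrrep n G) (x : G) :
    hsNormSq (V.mat x - 1) = 2 * V.dim - 2 * (V.character x).re := by
  have h := hsNormSq_eq_trace (V.mat x - 1)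
  have h1 : (V.mat x - 1)ᴴ * (V.mat x - 1) = 1 + 1 - V.mat x - (V.mat x)ᴴ := by
    rw [Matrix.conjTranspose_sub, Matrix.conjTranspose_one, Matrix.sub_mul, Matrix.mul_sub,
      Matrix.one_mul, V.conjTranspose_mul_mat, Matrix.mul_one]
    abel
  rw [h1, Matrix.trace_sub, Matrix.trace_sub, Matrix.trace_add, Matrix.trace_one,
    Matrix.trace_conjTranspose, Fintype.card_fin] at h
  have h2 := congrArg Complex.re h
  simp only [Complex.ofReal_re, Complex.sub_re, Complex.add_re, Complex.natCast_re,
    RCLike.star_def, Complex.conj_re] at h2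
  rw [h2, UnitaryIrrep.character]
  ring

theorem UnitaryIrrep.continuous_character (V : UnitaryIrrep n G) : Continuous V.character :=
  V.continuous_mat.matrix_trace

theorem UnitaryIrrep.norm_mat_apply_le (V : UnitaryIrrep n G) (x : G) (i j : Fin V.dim) :
    ‖V.mat x i j‖ ≤ 1 :=
  entry_norm_bound_of_unitary (V.hom x).2 i j

theorem UnitaryIrrep.norm_character_le (V : UnitaryIrrep n G) (x : G) :
    ‖V.character x‖ ≤ V.dim := by
  refine (norm_sum_le _ _).trans ((Finset.sum_le_sum fun i _ => V.norm_mat_apply_le x i i).trans ?_)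
  simp

variable (V : IrrepClass n G → UnitaryIrrep n G) (hV : ∀ lam, (V lam).cls = lam)
  [LieGroup (𝓡 n) ∞ G] [CompactSpace G] [MeasurableSpace G] [BorelSpace G]
  (ν : Measure G) [ν.IsHaarMeasure] [IsProbabilityMeasure ν]

/-- The squared `L²` norm of the reproducing kernel `∑ dim(λ) χ_λ` of a finite set of
representations is its value at the identity. -/
theorem integral_norm_sq_kernel (hV : ∀ lam, (V lam).cls = lam) (S : Finset (IrrepClass n G)) :
    ∫ x, ‖∑ lam ∈ S, ((V lam).dim : ℂ) * (V lam).character x‖ ^ 2 ∂ν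
      = ∑ lam ∈ S, ((V lam).dim : ℝ) ^ 2 := by
  have : IsTopologicalGroup G := topologicalGroup_of_lieGroup (𝓡 n) ∞
  have hint : ∀ lam lam' : IrrepClass n G, Integrable (fun x =>
      ((V lam).dim : ℂ) * (V lam').dim * ((V lam).character x * star ((V lam').character x))) ν :=
    fun lam lam' => integrable_of_continuous_of_compactSpace ν
      (continuous_const.mul ((V lam).continuous_character.mul (V lam').continuous_character.star))
  have h1 : ∀ x, ((‖∑ lam ∈ S, ((V lam).dim : ℂ) * (V lam).character x‖ ^ 2 : ℝ) : ℂ)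
      = ∑ lam ∈ S, ∑ lam' ∈ S, ((V lam).dim : ℂ) * (V lam').dim *
        ((V lam).character x * star ((V lam').character x)) := by
    intro x
    push_cast
    rw [← Complex.mul_conj', ← RCLike.star_def, star_sum, Finset.sum_mul_sum]
    refine Finset.sum_congr rfl fun lam _ => Finset.sum_congr rfl fun lam' _ => ?_
    rw [star_mul', star_natCast]
    ring
  have h2 : ((∫ x, ‖∑ lam ∈ S, ((V lam).dim : ℂ) * (V lam).character x‖ ^ 2 ∂ν : ℝ) : ℂ)
      = ((∑ lam ∈ S, ((V lam).dim : ℝ) ^ 2 : ℝ) : ℂ) := by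
    rw [← integral_complex_ofReal]
    simp only [h1]
    rw [integral_finsetSum _ fun lam _ => integrable_finsetSum _ fun lam' _ => hint lam lam']
    push_cast
    refine Finset.sum_congr rfl fun lam hlam => ?_
    rw [integral_finsetSum _ fun lam' _ => hint lam lam', Finset.sum_eq_single lam]
    · rw [integral_const_mul, integral_character_mul_star_self ν, mul_one, sq]
    · intro lam' _ hne
      rw [integral_const_mul, integral_character_mul_star_of_ne ν (by rwa [hV, hV]), mul_zero]
    · exact fun h => absurd hlam h
  exact_mod_cast h2

/-- The points at which every representation of `S` is within Hilbert–Schmidt distance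
`√dim` of the identity; there each character has real part at least half its maximum. -/
def nearOne (S : Finset (IrrepClass n G)) : Set G :=
  {x | ∀ lam ∈ S, hsNormSq ((V lam).mat x - 1) ≤ (V lam).dim}

theorem isClosed_nearOne (S : Finset (IrrepClass n G)) : IsClosed (nearOne V S) := by
  simp only [nearOne, Set.ofPred_forall]
  refine isClosed_biInter fun lam _ => isClosed_le ?_ continuous_const
  simp only [UnitaryIrrep.hsNormSq_mat_sub_one]
  have := (V lam).continuous_character
  fun_prop

/-- The kernel `f = ∑ dim(λ) χ_λ` has `‖f‖² = f(1)`, while `|f| ≥ f(1) / 2` on `nearOne`; hence a set of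
representations which are all close to `1` on a large set has small total dimension. -/
theorem sum_dim_sq_mul_measureReal_nearOne_le (hV : ∀ lam, (V lam).cls = lam)
    (S : Finset (IrrepClass n G)) :
    (∑ lam ∈ S, ((V lam).dim : ℝ) ^ 2) * ν.real (nearOne V S) ≤ 4 := by
  set D := ∑ lam ∈ S, ((V lam).dim : ℝ) ^ 2 with hD
  have hD0 : 0 ≤ D := Finset.sum_nonneg fun _ _ => sq_nonneg _
  have hlow : ∀ x ∈ nearOne V S, (D / 2) ^ 2 ≤
      ‖∑ lam ∈ S, ((V lam).dim : ℂ) * (V lam).character x‖ ^ 2 := by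
    intro x hx
    refine pow_le_pow_left₀ (by positivity) ?_ 2
    refine le_trans ?_ (Complex.re_le_norm _)
    rw [Complex.re_sum, hD, Finset.sum_div]
    refine Finset.sum_le_sum fun lam hlam => ?_
    have h1 := hx lam hlam
    rw [UnitaryIrrep.hsNormSq_mat_sub_one] at h1
    have h2 : (((V lam).dim : ℂ) * (V lam).character x).re
        = (V lam).dim * ((V lam).character x).re := by
      rw [← Complex.ofReal_natCast, Complex.re_ofReal_mul]
    rw [h2]
    have h3 : (0 : ℝ) ≤ (V lam).dim := Nat.cast_nonneg _
    nlinarith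
  have hcont : Continuous fun x => ‖∑ lam ∈ S, ((V lam).dim : ℂ) * (V lam).character x‖ ^ 2 := by
    have := fun lam => (V lam).continuous_character
    fun_prop
  have hint : Integrable (fun x => ‖∑ lam ∈ S, ((V lam).dim : ℂ) * (V lam).character x‖ ^ 2) ν :=
    (integrableOn_univ).1 (hcont.continuousOn.integrableOn_compact' isCompact_univ
      MeasurableSet.univ)
  have hmeas : MeasurableSet (nearOne V S) := (isClosed_nearOne V S).measurableSet
  have h1 : (D / 2) ^ 2 * ν.real (nearOne V S) ≤ D := by
    calc (D / 2) ^ 2 * ν.real (nearOne V S) = ∫ x in nearOne V S, (D / 2) ^ 2 ∂ν := by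
          rw [setIntegral_const, smul_eq_mul, mul_comm]
      _ ≤ ∫ x in nearOne V S, ‖∑ lam ∈ S, ((V lam).dim : ℂ) * (V lam).character x‖ ^ 2 ∂ν :=
          setIntegral_mono_on (integrableOn_const (measure_ne_top _ _)) hint.integrableOn hmeas hlow
      _ ≤ ∫ x, ‖∑ lam ∈ S, ((V lam).dim : ℂ) * (V lam).character x‖ ^ 2 ∂ν :=
          setIntegral_le_integral hint (ae_of_all _ fun x => sq_nonneg _)
      _ = D := integral_norm_sq_kernel V ν hV S
  rcases hD0.eq_or_lt with h | h
  · rw [← h, zero_mul]; norm_num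
  · refine le_of_mul_le_mul_left ?_ h
    nlinarith

/-- Subdividing a cube of the chart at the identity into `K^n` small cubes, each of which lies in
one translate of the set `nearOne`, bounds the Haar measure of that set from below. -/
theorem exists_measureReal_nearOne_ge :
    ∃ c > 0, ∃ M : ℕ, 0 < M ∧ ∀ (k : ℕ) (S : Finset (IrrepClass n G)),
      (∀ lam ∈ S, (V lam).energy ≤ (k + 1) * (V lam).dim) →
        c ≤ ((M * (k + 1)) ^ n : ℝ) * ν.real (nearOne V S) := by
  have : IsTopologicalGroup G := topologicalGroup_of_lieGroup (𝓡 n) ∞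
  obtain ⟨C, hC, r, hr, hlip⟩ := exists_lipschitz_chart (n := n) (G := G)
  set φ := extChartAt (𝓡 n) (1 : G) with hφ
  set e := φ 1 with he
  let W : Set G := φ.source ∩ φ ⁻¹' Metric.ball e r
  have hWo : IsOpen W := (continuousOn_extChartAt (I := 𝓡 n) (1 : G)).isOpen_inter_preimage
    (isOpen_extChartAt_source (1 : G)) Metric.isOpen_ball
  have hW : 0 < ν.real W := by
    refine ENNReal.toReal_pos (hWo.measure_pos ν ⟨1, ?_⟩).ne' (measure_ne_top _ _)
    exact ⟨mem_extChartAt_source (1 : G), Metric.mem_ball_self hr⟩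
  -- With `M (k + 1)` cells per edge, the Lipschitz bound on a cell is at most `√dim`.
  obtain ⟨M, hM⟩ := exists_nat_ge (1 + n * (C * (2 * r)) ^ 2)
  have hM1 : (1 : ℝ) ≤ M := le_trans (by nlinarith [show (0 : ℝ) ≤ n * (C * (2 * r)) ^ 2 by positivity]) hM
  refine ⟨ν.real W, hW, M, by exact_mod_cast hM1, fun k S hS => ?_⟩
  set K : ℕ := M * (k + 1) with hK
  have hK0 : (0 : ℝ) < K := by
    rw [hK]; push_cast; positivity
  set h : ℝ := 2 * r / K with hh
  have hh0 : 0 < h := by positivity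
  -- The cell of the grid of mesh `h` containing a given point.
  let idx : G → Fin n → ℕ := fun x i => ⌊(φ x i - e i + r) / h⌋₊
  have hcoord : ∀ x ∈ W, ∀ i, 0 ≤ (φ x i - e i + r) / h ∧ (φ x i - e i + r) / h < K := by
    intro x hx i
    have h1 : |φ x i - e i| < r := by
      have h2 := hx.2
      rw [Set.mem_preimage, mem_ball_iff_norm] at h2
      exact lt_of_le_of_lt (PiLp.norm_apply_le (φ x - e) i) h2
    rw [abs_lt] at h1
    refine ⟨div_nonneg (by linarith) hh0.le, ?_⟩
    rw [div_lt_iff₀ hh0, hh, mul_div_cancel₀ _ hK0.ne']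
    linarith
  have hidx : ∀ x ∈ W, idx x ∈ Fintype.piFinset fun _ : Fin n => Finset.range K := by
    intro x hx
    rw [Fintype.mem_piFinset]
    intro i
    rw [Finset.mem_range, Nat.floor_lt (hcoord x hx i).1]
    exact (hcoord x hx i).2
  have hclose : ∀ x ∈ W, ∀ y ∈ W, idx x = idx y → x⁻¹ * y ∈ nearOne V S := by
    intro x hx y hy hxy lam hlam
    have h1 : ‖φ x - φ y‖ ^ 2 ≤ n * h ^ 2 := by
      rw [EuclideanSpace.norm_sq_eq]
      calc ∑ i, ‖(φ x - φ y) i‖ ^ 2 ≤ ∑ _i : Fin n, h ^ 2 := by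
            refine Finset.sum_le_sum fun i _ => ?_
            rw [Real.norm_eq_abs, sq_abs]
            refine sq_le_sq' ?_ ?_
            all_goals
              have hi : ⌊(φ x i - e i + r) / h⌋₊ = ⌊(φ y i - e i + r) / h⌋₊ := congrFun hxy i
              have a1 := Nat.floor_le (hcoord x hx i).1
              have a2 := Nat.lt_floor_add_one ((φ x i - e i + r) / h)
              have a3 := Nat.floor_le (hcoord y hy i).1
              have a4 := Nat.lt_floor_add_one ((φ y i - e i + r) / h)
              rw [hi] at a1 a2
              have a5 : (φ x i - φ y i) / h
                  = (φ x i - e i + r) / h - (φ y i - e i + r) / h := by ring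
              rw [PiLp.sub_apply]
            · have : -1 ≤ (φ x i - φ y i) / h := by linarith
              rw [le_div_iff₀ hh0] at this
              linarith
            · have : (φ x i - φ y i) / h ≤ 1 := by linarith
              rw [div_le_iff₀ hh0] at this
              linarith
        _ = n * h ^ 2 := by simp
    have h2 := hlip (V lam) (φ x) hx.2 (φ y) hy.2
    rw [φ.left_inv hx.1, φ.left_inv hy.1] at h2
    have h3 : hsNormSq ((V lam).mat (x⁻¹ * y) - 1)
        = hsNormSq ((V lam).mat x - (V lam).mat y) := by
      have e1 : (V lam).mat x - (V lam).mat y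
          = (V lam).mat x * (-((V lam).mat (x⁻¹ * y) - 1)) := by
        rw [Matrix.mul_neg, Matrix.mul_sub, Matrix.mul_one, ← UnitaryIrrep.mat_mul,
          mul_inv_cancel_left, neg_sub]
      rw [e1, hsNormSq_mul_of_conjTranspose_mul_self ((V lam).conjTranspose_mul_mat x)]
      simp [hsNormSq, norm_sub_rev]
    rw [h3]
    refine h2.trans ?_
    have h4 : (C * ‖φ x - φ y‖) ^ 2 * (k + 1) ≤ 1 := by
      have h5 : h * K = 2 * r := by rw [hh]; field_simp
      have h6 : (K : ℝ) = M * (k + 1) := by rw [hK]; push_cast; ring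
      have h7 : n * (C * (2 * r)) ^ 2 * (k + 1) ≤ (K : ℝ) ^ 2 := by
        rw [h6]
        have hk1 : (1 : ℝ) ≤ k + 1 := by
          have : (0 : ℝ) ≤ k := Nat.cast_nonneg k
          linarith
        calc n * (C * (2 * r)) ^ 2 * (k + 1) ≤ M * (k + 1) := by gcongr; linarith
          _ = M * (k + 1) * 1 := (mul_one _).symm
          _ ≤ M * (k + 1) * (M * (k + 1)) := by gcongr; nlinarith
          _ = _ := by ring
      have h8 : (C * ‖φ x - φ y‖) ^ 2 * (k + 1) * (K : ℝ) ^ 2 ≤ 1 * (K : ℝ) ^ 2 := by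
        calc (C * ‖φ x - φ y‖) ^ 2 * (k + 1) * (K : ℝ) ^ 2
            = C ^ 2 * ‖φ x - φ y‖ ^ 2 * (k + 1) * (K : ℝ) ^ 2 := by ring
          _ ≤ C ^ 2 * (n * h ^ 2) * (k + 1) * (K : ℝ) ^ 2 := by gcongr
          _ = n * (C * (h * K)) ^ 2 * (k + 1) := by ring
          _ ≤ 1 * (K : ℝ) ^ 2 := by rw [h5, one_mul]; exact h7
      exact le_of_mul_le_mul_right h8 (by positivity)
    calc (C * ‖φ x - φ y‖) ^ 2 * (V lam).energy
        ≤ (C * ‖φ x - φ y‖) ^ 2 * ((k + 1) * (V lam).dim) := by gcongr; exact hS lam hlam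
      _ = (C * ‖φ x - φ y‖) ^ 2 * (k + 1) * (V lam).dim := by ring
      _ ≤ 1 * (V lam).dim := by gcongr
      _ = _ := one_mul _
  -- The cells of the grid cover `W`, and each is contained in a left translate of `nearOne`.
  have hcover : W ⊆ ⋃ t ∈ Fintype.piFinset fun _ : Fin n => Finset.range K,
      {x | x ∈ W ∧ idx x = t} := fun x hx => Set.mem_biUnion (hidx x hx) ⟨hx, rfl⟩
  have hpiece : ∀ t : Fin n → ℕ, ν.real {x | x ∈ W ∧ idx x = t} ≤ ν.real (nearOne V S) := by
    intro t
    rcases Set.eq_empty_or_nonempty {x | x ∈ W ∧ idx x = t} with h0 | ⟨x, hx⟩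
    · rw [h0, measureReal_empty]; exact measureReal_nonneg
    · have hs : {y | y ∈ W ∧ idx y = t} ⊆ (fun y => x⁻¹ * y) ⁻¹' nearOne V S := fun y hy =>
        hclose x hx.1 y hy.1 (hx.2.trans hy.2.symm)
      refine (measureReal_mono hs).trans (le_of_eq ?_)
      rw [measureReal_def, measureReal_def, measure_preimage_mul]
  calc ν.real W ≤ ∑ t ∈ Fintype.piFinset fun _ : Fin n => Finset.range K,
        ν.real {x | x ∈ W ∧ idx x = t} :=
        (measureReal_mono hcover (measure_ne_top _ _)).trans (measureReal_biUnion_finset_le _ _)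
    _ ≤ ∑ _t ∈ Fintype.piFinset fun _ : Fin n => Finset.range K, ν.real (nearOne V S) :=
        Finset.sum_le_sum fun t _ => hpiece t
    _ = _ := by
        rw [Finset.sum_const, Fintype.card_piFinset]
        simp [hK]

/-- The number of matrix coefficients with energy per dimension at most `k + 1` grows at most
polynomially in `k`. -/
theorem exists_sum_dim_sq_le (ν : Measure G) [ν.IsHaarMeasure] [IsProbabilityMeasure ν]
    (hV : ∀ lam, (V lam).cls = lam) :
    ∃ M : ℝ, ∀ (k : ℕ) (S : Finset (IrrepClass n G)),
      (∀ lam ∈ S, (V lam).energy ≤ (k + 1) * (V lam).dim) →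
        ∑ lam ∈ S, ((V lam).dim : ℝ) ^ 2 ≤ M * (k + 1) ^ n := by
  obtain ⟨c, hc, M, hM, h⟩ := exists_measureReal_nearOne_ge V ν
  refine ⟨4 * M ^ n / c, fun k S hS => ?_⟩
  have h1 := h k S hS
  have h2 := sum_dim_sq_mul_measureReal_nearOne_le V ν hV S
  set D := ∑ lam ∈ S, ((V lam).dim : ℝ) ^ 2 with hD
  have hD0 : 0 ≤ D := Finset.sum_nonneg fun _ _ => sq_nonneg _
  rw [div_mul_eq_mul_div, le_div_iff₀ hc]
  calc D * c ≤ D * (((M * (k + 1)) ^ n : ℝ) * ν.real (nearOne V S)) := by gcongr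
    _ = (M * (k + 1)) ^ n * (D * ν.real (nearOne V S)) := by ring
    _ ≤ (M * (k + 1)) ^ n * 4 := by gcongr
    _ = _ := by rw [mul_pow]; ring

theorem summable_dim_sq_mul_exp_neg_energy (ν : Measure G) [ν.IsHaarMeasure] [IsProbabilityMeasure ν]
    (hV : ∀ lam, (V lam).cls = lam) {a : ℝ} (ha : 0 < a) :
    Summable fun lam => ((V lam).dim : ℝ) ^ 2 *
      Real.exp (-a * ((V lam).energy / (V lam).dim)) := by
  obtain ⟨M, hM⟩ := exists_sum_dim_sq_le V ν hV
  have hM0 : 0 ≤ M := by simpa using hM 0 ∅ (by simp)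
  let b : ℕ → ℝ := fun k => M * (k + 1) ^ n * Real.exp (-a * k)
  have hb0 : ∀ k, 0 ≤ b k := fun k => by positivity
  have hb : Summable b := by
    have h1 := ((summable_nat_add_iff 1).2 (Real.summable_pow_mul_exp_neg_nat_mul n ha)).mul_left
      (M * Real.exp a)
    refine h1.congr fun k => ?_
    have h2 : Real.exp (-a * k) = Real.exp a * Real.exp (-a * ((k + 1 : ℕ) : ℝ)) := by
      rw [← Real.exp_add]; push_cast; ring_nf
    simp only [b]
    rw [h2]
    push_cast
    ring
  refine summable_of_sum_le (c := ∑' k, b k) (fun lam => by positivity) fun S => ?_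
  let q : IrrepClass n G → ℝ := fun lam => (V lam).energy / (V lam).dim
  have hq0 : ∀ lam, 0 ≤ q lam := fun lam => div_nonneg (V lam).energy_nonneg (Nat.cast_nonneg _)
  -- Grouping the representations by the integer part of the energy per dimension.
  calc ∑ lam ∈ S, ((V lam).dim : ℝ) ^ 2 * Real.exp (-a * q lam)
      = ∑ k ∈ S.image fun lam => ⌊q lam⌋₊, ∑ lam ∈ S with ⌊q lam⌋₊ = k,
          ((V lam).dim : ℝ) ^ 2 * Real.exp (-a * q lam) :=
        (Finset.sum_fiberwise_of_maps_to (fun lam h => Finset.mem_image_of_mem _ h) _).symm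
    _ ≤ ∑ k ∈ S.image fun lam => ⌊q lam⌋₊, b k := by
        refine Finset.sum_le_sum fun k _ => ?_
        calc _ ≤ ∑ lam ∈ S with ⌊q lam⌋₊ = k, ((V lam).dim : ℝ) ^ 2 * Real.exp (-a * k) := by
              refine Finset.sum_le_sum fun lam hlam => ?_
              have h1 := Nat.floor_le (hq0 lam)
              rw [(Finset.mem_filter.1 hlam).2] at h1
              refine mul_le_mul_of_nonneg_left (Real.exp_le_exp.2 ?_) (sq_nonneg _)
              nlinarith
          _ ≤ _ := by
              rw [← Finset.sum_mul]
              refine mul_le_mul_of_nonneg_right (hM k _ fun lam hlam => ?_) (Real.exp_pos _).le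
              have h1 := Nat.lt_floor_add_one (q lam)
              rw [(Finset.mem_filter.1 hlam).2] at h1
              have hd : (0 : ℝ) < (V lam).dim := by exact_mod_cast (V lam).dim_pos
              exact ((div_lt_iff₀ hd).1 h1).le
    _ ≤ ∑' k, b k := hb.sum_le_tsum _ fun k _ => hb0 k

/-- Convergence of the heat trace `∑ dim(λ)² exp(-A c₂(λ))`. -/
theorem summable_dim_sq_mul_exp_neg_casimir
    (ν : Measure G) [ν.IsHaarMeasure] [IsProbabilityMeasure ν]
    [LieAlgebra.IsSimple ℝ (GroupLieAlgebra (𝓡 n) G)] (hV : ∀ lam, (V lam).cls = lam)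
    {A : ℝ} (hA : 0 < A) :
    Summable fun lam => ((V lam).dim : ℝ) ^ 2 * Real.exp (-A * (V lam).c₂) := by
  obtain ⟨c, hc, hle⟩ := exists_pos_mul_energy_le (n := n) (G := G)
  refine Summable.of_nonneg_of_le (fun lam => by positivity) (fun lam => ?_)
    (summable_dim_sq_mul_exp_neg_energy V ν hV (mul_pos hA hc))
  refine mul_le_mul_of_nonneg_left (Real.exp_le_exp.2 ?_) (sq_nonneg _)
  have := mul_le_mul_of_nonneg_left (hle (V lam)) hA.le
  linarith

end Counting

/-! ### The cylinder integral of a product of characters -/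

section Strip

open Matrix

variable {n : ℕ} {G : Type*} [TopologicalSpace G]
  [ChartedSpace (EuclideanSpace ℝ (Fin n)) G] [Group G]

theorem UnitaryIrrep.character_strip (W : UnitaryIrrep n G) (x' h x h' : G) :
    W.character (x'⁻¹ * h⁻¹ * x * h') = ∑ q, ∑ r, ∑ q', ∑ r',
      (W.mat x q r * star (W.mat x' q' r')) * (star (W.mat h q q') * W.mat h' r r') := by
  rw [UnitaryIrrep.character, W.mat_mul, W.mat_mul, W.mat_mul, W.mat_inv, W.mat_inv]
  simp only [Matrix.trace, Matrix.diag_apply, Matrix.mul_apply, Matrix.conjTranspose_apply,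
    Finset.sum_mul]
  simp only [← Fintype.sum_prod_type']
  exact Fintype.sum_equiv ⟨fun y => (y.2.2.1, y.2.1, y.2.2.2, y.1),
    fun y => (y.2.2.2, y.2.1, y.1, y.2.2.1), fun _ => rfl, fun _ => rfl⟩ _ _ fun _ => by
      simp only [Equiv.coe_fn_mk]; ring

variable {N : ℕ} [NeZero N]

theorem traceFunction_apply (μ lam : Fin N → UnitaryIrrep n G)
    (a : ∀ i, Intertwiner (lam i) (lam (i - 1)) (μ i)) (g : Fin N → G) (s : TensorIndex μ) :
    traceFunction μ lam a g s = ∑ q : ∀ i, Fin (lam i).dim, ∑ r : ∀ i, Fin (lam i).dim,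
      ∏ i, (a i).1 (r (i - 1), s i) (q i) * (lam i).mat (g i) (q i) (r i) := by
  rw [Finset.sum_comm, traceFunction, cyclicTrace]
  refine Finset.sum_congr rfl fun r _ => ?_
  simp only [Matrix.mul_apply, Finset.prod_univ_sum, Fintype.piFinset_univ]
  rfl

/-- Shifting the cyclic index moves the right boundary `h_{i+1}` of each strip to the left boundary
of the next one. -/
theorem prod_shift (lam : Fin N → UnitaryIrrep n G) (h : Fin N → G)
    (r r' : ∀ i, Fin (lam i).dim) :
    ∏ i, (lam i).mat (h (i + 1)) (r i) (r' i)
      = ∏ i, (lam (i - 1)).mat (h i) (r (i - 1)) (r' (i - 1)) := by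
  rw [← Equiv.prod_comp (Equiv.subRight (1 : Fin N))]
  simp only [Equiv.subRight_apply, sub_add_cancel]
  rfl

theorem prod_character_strip (lam : Fin N → UnitaryIrrep n G) (g g' h : Fin N → G) :
    ∏ i, (lam i).character ((g' i)⁻¹ * (h i)⁻¹ * g i * h (i + 1))
      = ∑ q : ∀ i, Fin (lam i).dim, ∑ r : ∀ i, Fin (lam i).dim,
        ∑ q' : ∀ i, Fin (lam i).dim, ∑ r' : ∀ i, Fin (lam i).dim,
          (∏ i, (lam i).mat (g i) (q i) (r i) * star ((lam i).mat (g' i) (q' i) (r' i))) *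
          ∏ i, (lam (i - 1)).mat (h i) (r (i - 1)) (r' (i - 1)) *
            star ((lam i).mat (h i) (q i) (q' i)) := by
  simp only [UnitaryIrrep.character_strip, Finset.prod_univ_sum, Fintype.piFinset_univ]
  refine Finset.sum_congr rfl fun q _ => Finset.sum_congr rfl fun r _ =>
    Finset.sum_congr rfl fun q' _ => Finset.sum_congr rfl fun r' _ => ?_
  rw [Finset.prod_mul_distrib, Finset.prod_mul_distrib (f := fun i => star _), prod_shift,
    Finset.prod_mul_distrib (f := fun i => (lam (i - 1)).mat _ _ _)]
  ring

variable [LieGroup (𝓡 n) ∞ G] [CompactSpace G] [MeasurableSpace G] [BorelSpace G]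
  (ν : Measure G) [ν.IsHaarMeasure] [IsProbabilityMeasure ν]

/-- Integrating a product of characters of the strips against the Wilson lines produces the trace
functions of all intertwiners. -/
theorem integral_prod_character_strip (μ lam : Fin N → UnitaryIrrep n G) {m : Fin N → ℕ}
    (a : ∀ i, Module.Basis (Fin (m i)) ℂ (Intertwiner (lam i) (lam (i - 1)) (μ i)))
    (ha : ∀ i k l, (a i k).1ᴴ * (a i l).1 = if k = l then 1 else 0)
    (g g' : Fin N → G) (s t : TensorIndex μ) :
    ∫ h : Fin N → G, (∏ i, (lam i).character ((g' i)⁻¹ * (h i)⁻¹ * g i * h (i + 1))) *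
        tensorRep μ h s t ∂(Measure.pi fun _ => ν)
      = (∏ i, ((lam i).dim : ℂ)⁻¹) * ∑ k : ∀ i, Fin (m i),
          traceFunction μ lam (fun i => a i (k i)) g s *
            dualTraceFunction μ lam (fun i => a i (k i)) g' t := by
  have : IsTopologicalGroup G := topologicalGroup_of_lieGroup (𝓡 n) ∞
  have hsc : SecondCountableTopology G :=
    ChartedSpace.secondCountable_of_sigmaCompact (EuclideanSpace ℝ (Fin n)) G
  -- The factor attached to the `i`-th boundary line.
  let F : (∀ i, Fin (lam i).dim) → (∀ i, Fin (lam i).dim) → (∀ i, Fin (lam i).dim) →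
      (∀ i, Fin (lam i).dim) → ∀ i : Fin N, G → ℂ := fun q r q' r' i x =>
    (lam (i - 1)).mat x (r (i - 1)) (r' (i - 1)) * (μ i).mat x (s i) (t i) *
      star ((lam i).mat x (q i) (q' i))
  have hF : ∀ q r q' r' i, Continuous (F q r q' r' i) := fun q r q' r' i =>
    (((lam (i - 1)).continuous_mat.matrix_elem _ _).mul ((μ i).continuous_mat.matrix_elem _ _)).mul
      ((lam i).continuous_mat.matrix_elem _ _).star
  have hexp : ∀ h : Fin N → G,
      (∏ i, (lam i).character ((g' i)⁻¹ * (h i)⁻¹ * g i * h (i + 1))) * tensorRep μ h s t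
      = ∑ q : ∀ i, Fin (lam i).dim, ∑ r : ∀ i, Fin (lam i).dim,
        ∑ q' : ∀ i, Fin (lam i).dim, ∑ r' : ∀ i, Fin (lam i).dim,
          (∏ i, (lam i).mat (g i) (q i) (r i) * star ((lam i).mat (g' i) (q' i) (r' i))) *
          ∏ i, F q r q' r' i (h i) := by
    intro h
    rw [prod_character_strip]
    simp only [Finset.sum_mul]
    refine Finset.sum_congr rfl fun q _ => Finset.sum_congr rfl fun r _ =>
      Finset.sum_congr rfl fun q' _ => Finset.sum_congr rfl fun r' _ => ?_
    rw [mul_assoc, tensorRep, Matrix.of_apply, ← Finset.prod_mul_distrib]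
    congr 1
    exact Finset.prod_congr rfl fun i _ => by simp only [F]; ring
  have hint : ∀ q r q' r', Integrable (fun h : Fin N → G =>
      (∏ i, (lam i).mat (g i) (q i) (r i) * star ((lam i).mat (g' i) (q' i) (r' i))) *
        ∏ i, F q r q' r' i (h i)) (Measure.pi fun _ => ν) := fun q r q' r' =>
    integrable_of_continuous_of_compactSpace _ (continuous_const.mul
      (continuous_finsetProd _ fun i _ => (hF q r q' r' i).comp (continuous_apply i)))
  simp only [hexp]
  rw [integral_finsetSum _ fun q _ => integrable_finsetSum _ fun r _ =>
    integrable_finsetSum _ fun q' _ => integrable_finsetSum _ fun r' _ => hint q r q' r']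
  have hterm : ∀ q r q' r', ∫ h : Fin N → G,
      (∏ i, (lam i).mat (g i) (q i) (r i) * star ((lam i).mat (g' i) (q' i) (r' i))) *
        ∏ i, F q r q' r' i (h i) ∂(Measure.pi fun _ => ν)
      = ∑ k : ∀ i, Fin (m i), (∏ i, ((lam i).dim : ℂ)⁻¹) *
        ((∏ i, (a i (k i)).1 (r (i - 1), s i) (q i) * (lam i).mat (g i) (q i) (r i)) *
          ∏ i, star ((a i (k i)).1 (r' (i - 1), t i) (q' i) *
            (lam i).mat (g' i) (q' i) (r' i))) := by
    intro q r q' r'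
    rw [integral_const_mul, integral_fintype_prod_eq_prod]
    simp only [F, fun i => integral_vertex ν (lam i) (lam (i - 1)) (μ i) (a i) (ha i)
      (r (i - 1)) (r' (i - 1)) (s i) (t i) (q i) (q' i)]
    rw [Finset.prod_mul_distrib (f := fun i => ((lam i).dim : ℂ)⁻¹), Finset.prod_univ_sum,
      Fintype.piFinset_univ, mul_left_comm, Finset.mul_sum, Finset.mul_sum]
    refine Finset.sum_congr rfl fun k _ => ?_
    simp only [← Finset.prod_mul_distrib]
    exact Finset.prod_congr rfl fun i _ => by rw [star_mul']; ring
  simp only [dualTraceFunction_eq_star, Pi.star_apply, traceFunction_apply, star_sum, star_prod,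
    Finset.sum_mul]
  simp only [Finset.mul_sum]
  rw [Finset.sum_comm]
  refine Finset.sum_congr rfl fun q _ => ?_
  rw [integral_finsetSum _ fun r _ =>
    integrable_finsetSum _ fun q' _ => integrable_finsetSum _ fun r' _ => hint q r q' r',
    Finset.sum_comm]
  refine Finset.sum_congr rfl fun r _ => ?_
  rw [integral_finsetSum _ fun q' _ => integrable_finsetSum _ fun r' _ => hint q r q' r',
    Finset.sum_comm]
  refine Finset.sum_congr rfl fun q' _ => ?_
  rw [integral_finsetSum _ fun r' _ => hint q r q' r', Finset.sum_comm]
  refine Finset.sum_congr rfl fun r' _ => ?_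
  rw [hterm]

end Strip

/-! ### Summation over the spectral labels -/

section Summation

open Filter Topology

variable {ι β : Type*} [Fintype ι] [DecidableEq ι]

theorem sum_le_sum_piFinset_image [DecidableEq β] (f : ι → β → ℝ) (hf : ∀ i b, 0 ≤ f i b)
    (S : Finset (ι → β)) :
    ∑ x ∈ S, ∏ i, f i (x i) ≤ ∏ i, ∑ b ∈ S.image (fun x => x i), f i b := by
  rw [Finset.prod_univ_sum]
  exact Finset.sum_le_sum_of_subset_of_nonneg
    (fun x hx => Fintype.mem_piFinset.2 fun i => Finset.mem_image_of_mem _ hx)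
    fun x _ _ => Finset.prod_nonneg fun i _ => hf i _

theorem summable_pi_prod {f : ι → β → ℝ} (hf : ∀ i b, 0 ≤ f i b) (hs : ∀ i, Summable (f i)) :
    Summable fun x : ι → β => ∏ i, f i (x i) := by
  classical
  refine summable_of_sum_le (c := ∏ i, ∑' b, f i b)
    (fun x => Finset.prod_nonneg fun i _ => hf i _) fun S => ?_
  exact (sum_le_sum_piFinset_image f hf S).trans (Finset.prod_le_prod
    (fun i _ => Finset.sum_nonneg fun b _ => hf i b)
    fun i _ => (hs i).sum_le_tsum _ fun b _ => hf i b)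

/-- A finite product of absolutely convergent series is the series of products. -/
theorem hasSum_pi_prod {f : ι → β → ℂ} (hs : ∀ i, Summable fun b => ‖f i b‖) :
    HasSum (fun x : ι → β => ∏ i, f i (x i)) (∏ i, ∑' b, f i b) := by
  classical
  have hsum : Summable fun x : ι → β => ∏ i, f i (x i) := by
    refine Summable.of_norm ?_
    simp only [norm_prod]
    exact summable_pi_prod (f := fun i b => ‖f i b‖) (fun i b => norm_nonneg _) hs
  have h1 : Tendsto (fun T : Finset β => ∑ x ∈ Fintype.piFinset fun _ : ι => T, ∏ i, f i (x i))
      atTop (𝓝 (∑' x : ι → β, ∏ i, f i (x i))) := by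
    refine hsum.hasSum.comp (tendsto_atTop_finset_of_monotone
      (fun T T' h => Fintype.piFinset_subset _ _ fun _ => h) fun x => ?_)
    exact ⟨Finset.univ.image x, Fintype.mem_piFinset.2 fun i =>
      Finset.mem_image_of_mem _ (Finset.mem_univ i)⟩
  have h2 : Tendsto (fun T : Finset β => ∑ x ∈ Fintype.piFinset fun _ : ι => T, ∏ i, f i (x i))
      atTop (𝓝 (∏ i, ∑' b, f i b)) := by
    simp only [← Finset.prod_univ_sum]
    exact tendsto_finsetProd _ fun i _ => (Summable.of_norm (hs i)).hasSum
  rw [← tendsto_nhds_unique h1 h2]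
  exact hsum.hasSum

end Summation

section Assembly

open Matrix Filter Topology

variable {n : ℕ} {G : Type*} [TopologicalSpace G]
  [ChartedSpace (EuclideanSpace ℝ (Fin n)) G] [Group G] [LieGroup (𝓡 n) ∞ G]

/-- The summand `dim(λ)² exp(-A c₂(λ))` of the heat trace. -/
def heatWeight (V : IrrepClass n G → UnitaryIrrep n G) (A : ℝ) (lam : IrrepClass n G) : ℝ :=
  ((V lam).dim : ℝ) ^ 2 * Real.exp (-A * (V lam).c₂)

theorem heatWeight_pos (V : IrrepClass n G → UnitaryIrrep n G) (A : ℝ) (lam : IrrepClass n G) :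
    0 < heatWeight V A lam := by
  have : (0 : ℝ) < (V lam).dim := by exact_mod_cast (V lam).dim_pos
  unfold heatWeight
  positivity

theorem norm_discTerm_le (V : IrrepClass n G → UnitaryIrrep n G) (A : ℝ) (lam : IrrepClass n G)
    (x : G) : ‖discTerm (V lam) A x‖ ≤ heatWeight V A lam := by
  rw [discTerm, norm_mul, norm_mul, Complex.norm_natCast, Complex.norm_real,
    Real.norm_of_nonneg (Real.exp_pos _).le, heatWeight, sq]
  have := (V lam).norm_character_le x
  gcongr

variable {V : IrrepClass n G → UnitaryIrrep n G}

theorem continuous_discTerm (A : ℝ) (lam : IrrepClass n G) : Continuous (discTerm (V lam) A) :=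
  ((V lam).continuous_character.mul continuous_const).mul continuous_const

theorem continuous_discPartition {A : ℝ} (hs : Summable (heatWeight V A)) :
    Continuous (discPartition V A) :=
  continuous_tsum (continuous_discTerm A) hs fun lam x => norm_discTerm_le V A lam x

variable {N : ℕ} [NeZero N] {μ : Fin N → UnitaryIrrep n G}

/-- The contribution of the representations `λ_1, …, λ_N` to an entry of the cylinder integrand. -/
def cylinderTerm (V : IrrepClass n G → UnitaryIrrep n G) (μ : Fin N → UnitaryIrrep n G)
    (A : Fin N → ℝ) (g g' : Fin N → G) (s t : TensorIndex μ) (lam : Fin N → IrrepClass n G)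
    (h : Fin N → G) : ℂ :=
  (∏ i, discTerm (V (lam i)) (A i) ((g' i)⁻¹ * (h i)⁻¹ * g i * h (i + 1))) * tensorRep μ h s t

theorem norm_tensorRep_le (h : Fin N → G) (s t : TensorIndex μ) : ‖tensorRep μ h s t‖ ≤ 1 := by
  rw [tensorRep, Matrix.of_apply, norm_prod]
  exact Finset.prod_le_one (fun _ _ => norm_nonneg _) fun i _ => (μ i).norm_mat_apply_le _ _ _

theorem continuous_tensorRep (s t : TensorIndex μ) :
    Continuous fun h : Fin N → G => tensorRep μ h s t := by
  simp only [tensorRep, Matrix.of_apply]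
  exact continuous_finsetProd _ fun i _ =>
    ((μ i).continuous_mat.matrix_elem (s i) (t i)).comp (continuous_apply i)

theorem norm_cylinderTerm_le (A : Fin N → ℝ) (g g' : Fin N → G) (s t : TensorIndex μ)
    (lam : Fin N → IrrepClass n G) (h : Fin N → G) :
    ‖cylinderTerm V μ A g g' s t lam h‖ ≤ ∏ i, heatWeight V (A i) (lam i) := by
  rw [cylinderTerm, norm_mul, norm_prod]
  calc _ ≤ (∏ i, heatWeight V (A i) (lam i)) * 1 :=
        mul_le_mul (Finset.prod_le_prod (fun _ _ => norm_nonneg _)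
          fun i _ => norm_discTerm_le V _ _ _) (norm_tensorRep_le h s t) (norm_nonneg _)
          (Finset.prod_nonneg fun i _ => (heatWeight_pos V _ _).le)
    _ = _ := mul_one _

theorem continuous_strip [IsTopologicalGroup G] (g g' : Fin N → G) (i : Fin N) :
    Continuous fun h : Fin N → G => (g' i)⁻¹ * (h i)⁻¹ * g i * h (i + 1) := by
  fun_prop

theorem continuous_cylinderTerm (A : Fin N → ℝ) (g g' : Fin N → G) (s t : TensorIndex μ)
    (lam : Fin N → IrrepClass n G) : Continuous (cylinderTerm V μ A g g' s t lam) :=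
  have : IsTopologicalGroup G := topologicalGroup_of_lieGroup (𝓡 n) ∞
  (continuous_finsetProd _ fun i _ =>
    (continuous_discTerm (A i) (lam i)).comp (continuous_strip g g' i)).mul
    (continuous_tensorRep s t)

theorem hasSum_cylinderTerm {A : Fin N → ℝ} (hs : ∀ i, Summable (heatWeight V (A i)))
    (g g' : Fin N → G) (s t : TensorIndex μ) (h : Fin N → G) :
    HasSum (fun lam => cylinderTerm V μ A g g' s t lam h) (cylinderIntegrand V μ A g g' h s t) :=
  (hasSum_pi_prod fun i => (hs i).of_nonneg_of_le (fun _ => norm_nonneg _)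
    fun lam => norm_discTerm_le V (A i) lam _).mul_right _

variable [CompactSpace G] [MeasurableSpace G] [BorelSpace G]
  (ν : Measure G) [ν.IsHaarMeasure] [IsProbabilityMeasure ν]

theorem integrable_cylinderIntegrand {A : Fin N → ℝ} (hs : ∀ i, Summable (heatWeight V (A i)))
    (g g' : Fin N → G) (s t : TensorIndex μ) :
    Integrable (fun h => cylinderIntegrand V μ A g g' h s t) (Measure.pi fun _ : Fin N => ν) := by
  have : SecondCountableTopology G :=
    ChartedSpace.secondCountable_of_sigmaCompact (EuclideanSpace ℝ (Fin n)) G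
  have : IsTopologicalGroup G := topologicalGroup_of_lieGroup (𝓡 n) ∞
  exact integrable_of_continuous_of_compactSpace _ ((continuous_finsetProd _ fun i _ =>
    (continuous_discPartition (hs i)).comp (continuous_strip g g' i)).mul
    (continuous_tensorRep s t))

/-- Summing the propagator over the intertwiners with fixed representations gives the integral of
the corresponding term of the cylinder integrand. -/
theorem sum_propagatorTerm {a : VertexBases V μ} (ha : a.IsOrthonormal) (A : Fin N → ℝ)
    (g g' : Fin N → G) (s t : TensorIndex μ) (lam : Fin N → IrrepClass n G) :
    ∑ k, propagatorTerm V μ a A g g' ⟨lam, k⟩ s t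
      = ∫ h, cylinderTerm V μ A g g' s t lam h ∂(Measure.pi fun _ : Fin N => ν) := by
  have h1 := integral_prod_character_strip ν μ (fun i => V (lam i))
    (fun i => a i (lam i) (lam (i - 1))) (fun i => ha i (lam i) (lam (i - 1))) g g' s t
  have h2 : ∀ h : Fin N → G, cylinderTerm V μ A g g' s t lam h
      = (∏ i, ((V (lam i)).dim : ℂ) * ((Real.exp (-A i * (V (lam i)).c₂) : ℝ) : ℂ)) *
        ((∏ i, (V (lam i)).character ((g' i)⁻¹ * (h i)⁻¹ * g i * h (i + 1))) *
          tensorRep μ h s t) := by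
    intro h
    rw [cylinderTerm, ← mul_assoc, ← Finset.prod_mul_distrib]
    congr 1
    exact Finset.prod_congr rfl fun i _ => by rw [discTerm]; ring
  simp only [h2]
  rw [integral_const_mul, h1, ← mul_assoc, ← Finset.prod_mul_distrib, Finset.mul_sum]
  refine Finset.sum_congr rfl fun k _ => ?_
  have h3 : ∏ i, (((V (lam i)).dim : ℂ) * ((Real.exp (-A i * (V (lam i)).c₂) : ℝ) : ℂ) *
      ((V (lam i)).dim : ℂ)⁻¹) = ((Real.exp (-∑ i, (V (lam i)).c₂ * A i) : ℝ) : ℂ) := by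
    rw [← Finset.sum_neg_distrib, Real.exp_sum, Complex.ofReal_prod]
    refine Finset.prod_congr rfl fun i _ => ?_
    have : ((V (lam i)).dim : ℂ) ≠ 0 := by exact_mod_cast (V (lam i)).dim_pos.ne'
    rw [mul_comm ((V (lam i)).dim : ℂ), mul_assoc, mul_inv_cancel₀ this, mul_one]
    congr 2
    ring
  rw [h3]
  rfl

theorem norm_integral_cylinderTerm_le (A : Fin N → ℝ) (g g' : Fin N → G) (s t : TensorIndex μ)
    (lam : Fin N → IrrepClass n G) :
    ‖∫ h, cylinderTerm V μ A g g' s t lam h ∂(Measure.pi fun _ : Fin N => ν)‖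
      ≤ ∏ i, heatWeight V (A i) (lam i) := by
  refine (norm_integral_le_of_norm_le_const
    (ae_of_all _ (norm_cylinderTerm_le A g g' s t lam))).trans (le_of_eq ?_)
  simp

/-- The diagonal entries of the propagator with `g = g'` form a convergent series of nonnegative
terms. -/
theorem summable_norm_sq_traceFunction (ν : Measure G) [ν.IsHaarMeasure] [IsProbabilityMeasure ν]
    {a : VertexBases V μ} (ha : a.IsOrthonormal)
    {A : Fin N → ℝ} (hs : ∀ i, Summable (heatWeight V (A i))) (g : Fin N → G)
    (s : TensorIndex μ) :
    Summable fun x : SpectralLabel V μ => Real.exp (-∑ i, (V (x.1 i)).c₂ * A i) *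
      ‖traceFunction μ (fun i => V (x.1 i)) (fun i => a i (x.1 i) (x.1 (i - 1)) (x.2 i)) g s‖ ^ 2 := by
  have hterm : ∀ x : SpectralLabel V μ, propagatorTerm V μ a A g g x s s =
      ((Real.exp (-∑ i, (V (x.1 i)).c₂ * A i) * ‖traceFunction μ (fun i => V (x.1 i))
        (fun i => a i (x.1 i) (x.1 (i - 1)) (x.2 i)) g s‖ ^ 2 : ℝ) : ℂ) := by
    intro x
    rw [propagatorTerm, dualTraceFunction_eq_star, Matrix.smul_apply, Matrix.vecMulVec_apply,
      Pi.star_apply, RCLike.star_def, Complex.mul_conj', smul_eq_mul]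
    push_cast
    rfl
  rw [summable_sigma_of_nonneg fun x => by positivity]
  refine ⟨fun lam => (hasSum_fintype _).summable, ?_⟩
  refine Summable.of_nonneg_of_le (fun lam => tsum_nonneg fun k => by positivity) (fun lam => ?_)
    (summable_pi_prod (fun i b => (heatWeight_pos V (A i) b).le) hs)
  rw [tsum_fintype]
  refine le_trans (le_of_eq ?_) (norm_integral_cylinderTerm_le ν A g g s s lam)
  rw [← sum_propagatorTerm ν ha]
  simp only [hterm]
  rw [← Complex.ofReal_sum, Complex.norm_real, Real.norm_of_nonneg
    (Finset.sum_nonneg fun k _ => by positivity)]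

/-- By the arithmetic-geometric mean inequality, the off-diagonal terms are dominated by the diagonal
ones. -/
theorem summable_propagatorTerm_apply (ν : Measure G) [ν.IsHaarMeasure] [IsProbabilityMeasure ν]
    {a : VertexBases V μ} (ha : a.IsOrthonormal)
    {A : Fin N → ℝ} (hs : ∀ i, Summable (heatWeight V (A i))) (g g' : Fin N → G)
    (s t : TensorIndex μ) : Summable fun x => propagatorTerm V μ a A g g' x s t := by
  refine Summable.of_norm_bounded (((summable_norm_sq_traceFunction ν ha hs g s).add
    (summable_norm_sq_traceFunction ν ha hs g' t)).mul_left (1 / 2)) fun x => ?_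
  rw [propagatorTerm, dualTraceFunction_eq_star, Matrix.smul_apply, Matrix.vecMulVec_apply,
    Pi.star_apply, norm_smul, norm_mul, norm_star, Complex.norm_real,
    Real.norm_of_nonneg (Real.exp_pos _).le, ← mul_add, mul_left_comm (1 / 2 : ℝ)]
  refine mul_le_mul_of_nonneg_left ?_ (Real.exp_pos _).le
  have := two_mul_le_add_sq ‖traceFunction μ (fun i => V (x.1 i))
    (fun i => a i (x.1 i) (x.1 (i - 1)) (x.2 i)) g s‖ ‖traceFunction μ (fun i => V (x.1 i))
    (fun i => a i (x.1 i) (x.1 (i - 1)) (x.2 i)) g' t‖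
  linarith

theorem summable_propagatorTerm (ν : Measure G) [ν.IsHaarMeasure] [IsProbabilityMeasure ν]
    {a : VertexBases V μ} (ha : a.IsOrthonormal)
    {A : Fin N → ℝ} (hs : ∀ i, Summable (heatWeight V (A i))) (g g' : Fin N → G) :
    Summable (propagatorTerm V μ a A g g') :=
  Pi.summable.2 fun s => Pi.summable.2 fun t => summable_propagatorTerm_apply ν ha hs g g' s t

theorem propagatorKernel_eq_integral {a : VertexBases V μ} (ha : a.IsOrthonormal)
    {A : Fin N → ℝ} (hs : ∀ i, Summable (heatWeight V (A i))) (g g' : Fin N → G)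
    (s t : TensorIndex μ) :
    propagatorKernel V μ a A g g' s t =
      ∫ h, cylinderIntegrand V μ A g g' h s t ∂(Measure.pi fun _ : Fin N => ν) := by
  have hsc : SecondCountableTopology G :=
    ChartedSpace.secondCountable_of_sigmaCompact (EuclideanSpace ℝ (Fin n)) G
  -- Interchanging sum and integral needs countably many labels: all weights are positive and summable.
  have hcount : Countable (IrrepClass n G) := by
    have h := (hs 0).countable_support
    rw [Function.support_eq_univ fun lam => (heatWeight_pos V (A 0) lam).ne'] at h
    exact Set.countable_univ_iff.1 h
  have h1 : propagatorKernel V μ a A g g' s t = ∑' x, propagatorTerm V μ a A g g' x s t := by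
    have h2 := summable_propagatorTerm ν ha hs g g'
    have h3 : HasSum (fun x => propagatorTerm V μ a A g g' x s)
        (propagatorKernel V μ a A g g' s) := Pi.hasSum.1 h2.hasSum s
    exact (Pi.hasSum.1 h3 t).tsum_eq.symm
  have h4 : HasSum (fun lam => ∫ h, cylinderTerm V μ A g g' s t lam h
      ∂(Measure.pi fun _ : Fin N => ν))
      (∫ h, cylinderIntegrand V μ A g g' h s t ∂(Measure.pi fun _ : Fin N => ν)) := by
    refine hasSum_integral_of_dominated_convergence
      (fun lam _ => ∏ i, heatWeight V (A i) (lam i))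
      (fun lam => (integrable_of_continuous_of_compactSpace _
        (continuous_cylinderTerm A g g' s t lam)).aestronglyMeasurable)
      (fun lam => ae_of_all _ (norm_cylinderTerm_le A g g' s t lam))
      (ae_of_all _ fun _ => summable_pi_prod (fun i b => (heatWeight_pos V (A i) b).le) hs)
      (integrable_const _)
      (ae_of_all _ fun h => hasSum_cylinderTerm hs g g' s t h)
  rw [h1, (summable_propagatorTerm_apply ν ha hs g g' s t).tsum_sigma, ← h4.tsum_eq]
  refine tsum_congr fun lam => ?_
  rw [tsum_fintype, sum_propagatorTerm ν ha]

end Assembly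

end SpinCM

end

theorem mainTheorem6 {n : ℕ} {G : Type*} [TopologicalSpace G]
    [ChartedSpace (EuclideanSpace ℝ (Fin n)) G] [Group G] [LieGroup (𝓡 n) ∞ G]
    [T2Space G] [CompactSpace G] [SimplyConnectedSpace G]
    [LieAlgebra.IsSimple ℝ (GroupLieAlgebra (𝓡 n) G)]
    [MeasurableSpace G] [BorelSpace G]
    (ν : Measure G) [ν.IsHaarMeasure] [IsProbabilityMeasure ν]
    {N : ℕ} [NeZero N] (μ : Fin N → SpinCM.UnitaryIrrep n G)
    (V : SpinCM.IrrepClass n G → SpinCM.UnitaryIrrep n G) (hV : ∀ lam, (V lam).cls = lam)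
    (a : SpinCM.VertexBases V μ) (ha : a.IsOrthonormal)
    (A : Fin N → ℝ) (hA : ∀ i, 0 < A i) :
    (∀ (i : Fin N) (x : G), Summable fun lam => SpinCM.discTerm (V lam) (A i) x) ∧
    ∀ g g' : Fin N → G,
      (Summable fun x => SpinCM.propagatorTerm V μ a A g g' x) ∧
      ∀ s t : SpinCM.TensorIndex μ,
        Integrable (fun h => SpinCM.cylinderIntegrand V μ A g g' h s t)
          (Measure.pi fun _ : Fin N => ν) ∧
        SpinCM.propagatorKernel V μ a A g g' s t =
          ∫ h, SpinCM.cylinderIntegrand V μ A g g' h s t ∂(Measure.pi fun _ : Fin N => ν) := by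
  have hs : ∀ i, Summable (SpinCM.heatWeight V (A i)) := fun i =>
    SpinCM.summable_dim_sq_mul_exp_neg_casimir V ν hV (hA i)
  refine ⟨fun i x => Summable.of_norm_bounded (hs i) fun lam => SpinCM.norm_discTerm_le V (A i) lam x,
    fun g g' => ⟨SpinCM.summable_propagatorTerm ν ha hs g g', fun s t =>
      ⟨SpinCM.integrable_cylinderIntegrand ν hs g g' s t,
        SpinCM.propagatorKernel_eq_integral ν ha hs g g' s t⟩⟩⟩
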